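/- Let $m\ge 4$ be an integer and let $G$ be a finite group. Let $V=G_1\cup\dots\cup G_m$ be the disjoint union of $m$ copies $G_i=\{x_i : x\in G\}$ of $G$. An $m$-PCayley digraph of $G$ is a digraph with vertex set $V$ and arc set $\bigcup_{1\le i,j\le m}\{(x_i,(sx)_j) : x\in G,\ s\in S_{i,j}\}$, for some subsets $S_{i,j}\subseteq G$ $(1\le i,j\le m)$ with $S_{i,i}=\emptyset$ for all $i$; it is called an $m$-PCayley graph if its arc set is symmetric. For $g\in G$ let $R(g)$ be the permutation $x_i\mapsto (xg)_i$ of $V$, let $R(G)=\{R(g): g\in G\}$, and let $N$ be the normalizer of $R(G)$ in the symmetric group on $V$. An $m$-PCayley (di)graph $\Gamma$ of $G$ is called $m$PCI if for every $m$-PCayley (di)graph $\Sigma$ of $G$ for which there is an isomorphism from $\Gamma$ to $\Sigma$ mapping each $G_i$ onto some $G_j$, there is $n\in N$ with $\Gamma^n=\Sigma$, where $\Gamma^n$ is the digraph on $V$ with arcs $(u^n,v^n)$ for the arcs $(u,v)$ of $\Gamma$. The group $G$ is called $m$PCI if every $m$-PCayley graph of $G$ is $m$PCI, and $m$PDCI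 if every $m$-PCayley digraph of $G$ is $m$PCI. Then: (1) $G$ is $m$PCI if and only if $G\cong\mathbb{Z}_1$, or $G\cong\mathbb{Z}_2$, or $m\in\{4,5\}$ and $G$ is isomorphic to $\mathbb{Z}_3$ or to the dihedral group $D_6$ of order $6$; (2) $G$ is $m$PDCI if and only if $G\cong\mathbb{Z}_1$ or $G\cong\mathbb{Z}_2$. -/

import Mathlib

namespace MCayley

variable {m : ℕ} {G : Type*} [Group G]

/-- The `m`-Cayley digraph `Cay(G, S i j)`: the vertex `(i, x)` is the element `x` of the
`i`-th copy of `G`, and the arcs are the pairs `((i, x), (j, s * x))` with `s ∈ S i j`. -/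
def cay (S : Fin m → Fin m → Set G) : Digraph (Fin m × G) where
  Adj u v := ∃ s ∈ S u.1 v.1, v.2 = s * u.2

/-- `Γ` is an `m`-PCayley digraph of `G`: an `m`-Cayley digraph with all `S i i` empty. -/
def IsPCayleyDigraph (Γ : Digraph (Fin m × G)) : Prop :=
  ∃ S : Fin m → Fin m → Set G, (∀ i, S i i = ∅) ∧ Γ = cay S

/-- A digraph is a graph if its arc set is symmetric. -/
def IsGraph {V : Type*} (Γ : Digraph V) : Prop :=
  ∀ u v, Γ.Adj u v → Γ.Adj v u

/-- `Γ` is an `m`-PCayley graph of `G`. -/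
def IsPCayleyGraph (Γ : Digraph (Fin m × G)) : Prop :=
  IsPCayleyDigraph Γ ∧ IsGraph Γ

/-- The image `Γ ^ σ` of a digraph under a permutation of its vertices: its arcs are the
pairs `(σ u, σ v)` with `(u, v)` an arc of `Γ`. -/
def image {V : Type*} (Γ : Digraph V) (σ : Equiv.Perm V) : Digraph V where
  Adj a b := ∃ u v, Γ.Adj u v ∧ σ u = a ∧ σ v = b

variable (m) in
/-- The right multiplication `(i, x) ↦ (i, x * g)`. -/
def rightMul (g : G) : Equiv.Perm (Fin m × G) :=
  Equiv.prodCongr (Equiv.refl (Fin m)) (Equiv.mulRight g)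

variable (m G) in
/-- The group `R(G)` of all right multiplications on `m` copies of `G`. -/
def rightMulGroup : Subgroup (Equiv.Perm (Fin m × G)) where
  carrier := Set.range (rightMul m)
  one_mem' := ⟨1, by ext x <;> simp [rightMul]⟩
  mul_mem' := by
    rintro _ _ ⟨g, rfl⟩ ⟨h, rfl⟩
    exact ⟨h * g, by ext x <;> simp [rightMul, mul_assoc]⟩
  inv_mem' := by
    rintro _ ⟨g, rfl⟩
    refine ⟨g⁻¹, eq_inv_of_mul_eq_one_left ?_⟩
    ext x <;> simp [rightMul]

variable (G) in
/-- The `i`-th copy `G_i` of `G` in the vertex set. -/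
def block (i : Fin m) : Set (Fin m × G) := {v | v.1 = i}

/-- `Γ` and `Δ` are `p`-isomorphic: there is an isomorphism from `Γ` to `Δ` that maps every
`G_i` onto some `G_j`. -/
def PIsomorphic (Γ Δ : Digraph (Fin m × G)) : Prop :=
  ∃ σ : Equiv.Perm (Fin m × G),
    (∀ u v, Γ.Adj u v ↔ Δ.Adj (σ u) (σ v)) ∧ ∀ i, ∃ j, σ '' block G i = block G j

/-- The `m`-PCayley digraph `Γ` is `m`PCI: each `m`-PCayley digraph of `G` that is
`p`-isomorphic to `Γ` is the image of `Γ` under an element of the normalizer of `R(G)` in the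
symmetric group on the vertices. If `Γ` is a graph, then so is every such digraph, so that
the same definition serves graphs. -/
def IsPCI (Γ : Digraph (Fin m × G)) : Prop :=
  ∀ Δ : Digraph (Fin m × G), IsPCayleyDigraph Δ → PIsomorphic Γ Δ →
    ∃ n ∈ Subgroup.normalizer (rightMulGroup m G : Set (Equiv.Perm (Fin m × G))),
      image Γ n = Δ

variable (m G) in
/-- `G` is an `m`PCI-group: every `m`-PCayley graph of `G` is `m`PCI. -/
def IsPCIGroup : Prop :=
  ∀ Γ : Digraph (Fin m × G), IsPCayleyGraph Γ → IsPCI Γ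

variable (m G) in
/-- `G` is an `m`PDCI-group: every `m`-PCayley digraph of `G` is `m`PCI. -/
def IsPDCIGroup : Prop :=
  ∀ Γ : Digraph (Fin m × G), IsPCayleyDigraph Γ → IsPCI Γ

end MCayley

/-!
Let `H` be a subgroup of `G`. Connection sets in `H` on `k ≤ m` copies define an `m`-PCayley
digraph of `G` that consists of one copy of the digraph of `H` for each coset and of isolated
vertices, and for connected digraphs of `H` an element of the normalizer of `R(G)` relating two
such digraphs of `G` yields an affine map `(i, x) ↦ (π i, g i * α x)` relating those of `H`. So
two families of connection sets that are related by permutations of the single copies of `H`, but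
by no affine map, show that `G` is not `m`PCI. Families that form a square rule out the elements of
order `4`, `6` and odd order at least `5` and the noncyclic subgroups of order `p ^ 2`, which
leaves the groups of order dividing `6` other than `Z_6`. If `G` has elements of order `3`, then
two triangles over `Z_3` force `m ≤ 5`, and two directed digons show that `G` is not `m`PDCI.

Conversely, as in Babai's criterion, an isomorphism `σ` is corrected by automorphisms until it
normalizes `R(G)`. Let `ρ` have order `3`. By Sylow's theorem, `σ⁻¹ R(ρ) σ` may be assumed to have
the same cycles as `R(ρ)`, each possibly inverted. An inverted cycle and one that is not inverted
are completely joined or not joined at all, so an automorphism may act on the cycles of one kind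
alone. In `D_6` this serves to make the two cycles in each block be of the same kind. Then, as
`m ≤ 5`, one of the kinds occurs in at most two blocks, where an automorphism that inverts the
cycles can be written down. Now `σ` normalizes `⟨R(ρ)⟩`, and in `D_6` a last correction by `R(τ)`
and its conjugate, where `τ` is an involution, makes `σ` normalize `⟨R(τ)⟩` as well.
-/

namespace MCayley

open Multiplicative (ofAdd)

variable {m : ℕ} {G : Type*} [Group G]

/-! ### Right multiplications and their normalizer -/

@[simp]
theorem rightMul_apply (g : G) (v : Fin m × G) : rightMul m g v = (v.1, v.2 * g) := rfl

theorem rightMul_mul (g h : G) : rightMul m (g * h) = rightMul m h * rightMul m g :=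
  Equiv.ext fun v => by simp [mul_assoc]

theorem rightMul_one : rightMul m (1 : G) = 1 := by
  ext <;> simp

theorem rightMul_inv (g : G) : rightMul m g⁻¹ = (rightMul m g)⁻¹ := by
  rw [eq_inv_iff_mul_eq_one, ← rightMul_mul, mul_inv_cancel, rightMul_one]

theorem rightMul_pow (g : G) (k : ℕ) : rightMul m (g ^ k) = rightMul m g ^ k := by
  induction k with
  | zero => rw [pow_zero, pow_zero, rightMul_one]
  | succ k ih => rw [pow_succ', rightMul_mul, ih, pow_succ]

theorem rightMul_injective (hm : 0 < m) : Function.Injective (rightMul m : G → _) := by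
  intro g h hgh
  simpa using congrArg (fun f : Equiv.Perm (Fin m × G) => (f (⟨0, hm⟩, 1)).2) hgh

theorem rightMul_mem_rightMulGroup (g : G) : rightMul m g ∈ rightMulGroup m G := ⟨g, rfl⟩

theorem cay_adj_iff {S : Fin m → Fin m → Set G} {u v : Fin m × G} :
    (cay S).Adj u v ↔ v.2 * u.2⁻¹ ∈ S u.1 v.1 := by
  constructor
  · rintro ⟨s, hs, h⟩
    simpa [h] using hs
  · exact fun h => ⟨_, h, by simp⟩

theorem cay_adj_rightMul (S : Fin m → Fin m → Set G) (g : G) (u v : Fin m × G) :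
    (cay S).Adj (rightMul m g u) (rightMul m g v) ↔ (cay S).Adj u v := by
  simp [cay_adj_iff, mul_assoc]

theorem isGraph_cay {S : Fin m → Fin m → Set G} (hS : ∀ i j, ∀ s ∈ S i j, s⁻¹ ∈ S j i) :
    IsGraph (cay S) := by
  intro u v h
  rw [cay_adj_iff] at h ⊢
  simpa using hS _ _ _ h

theorem image_adj_apply {V : Type*} (Γ : Digraph V) (σ : Equiv.Perm V) (u v : V) :
    (image Γ σ).Adj (σ u) (σ v) ↔ Γ.Adj u v := by
  constructor
  · rintro ⟨a, b, h, ha, hb⟩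
    rwa [← σ.injective ha, ← σ.injective hb]
  · exact fun h => ⟨u, v, h, rfl, rfl⟩

theorem image_eq_of_adj_iff {V : Type*} {Γ Δ : Digraph V} {σ : Equiv.Perm V}
    (h : ∀ u v, Γ.Adj u v ↔ Δ.Adj (σ u) (σ v)) : image Γ σ = Δ := by
  ext a b
  obtain ⟨u, rfl⟩ := σ.surjective a
  obtain ⟨v, rfl⟩ := σ.surjective b
  rw [image_adj_apply, h]

theorem fst_apply_eq_iff_of_image_block {X : Type*} {σ : Equiv.Perm (Fin m × X)}
    (hσ : ∀ i, ∃ j, σ '' block X i = block X j) (u v : Fin m × X) :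
    (σ u).1 = (σ v).1 ↔ u.1 = v.1 := by
  choose π hπ using hσ
  have fst_apply (w) : (σ w).1 = π w.1 := (hπ w.1).subset ⟨w, rfl, rfl⟩
  constructor
  · intro h
    obtain ⟨w, hw, hwv⟩ : σ v ∈ σ '' block X u.1 :=
      (hπ u.1).superset (h.symm.trans (fst_apply u))
    rw [← σ.injective hwv]
    exact hw.symm
  · intro h
    rw [fst_apply, fst_apply, h]

section Normalizer

variable {n : Equiv.Perm (Fin m × G)}

theorem exists_mulEquiv_conj_rightMul (hm : 0 < m)
    (hn : n ∈ Subgroup.normalizer (rightMulGroup m G : Set (Equiv.Perm (Fin m × G)))) :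
    ∃ α : G ≃* G, ∀ x, n * rightMul m x * n⁻¹ = rightMul m (α x) := by
  have conj_mem (x : G) : ∃ y, rightMul m y = n * rightMul m x * n⁻¹ :=
    (Subgroup.mem_normalizer_iff.1 hn _).1 (rightMul_mem_rightMulGroup x)
  choose a ha using conj_mem
  have hinj : Function.Injective a := by
    intro x y hxy
    apply rightMul_injective hm
    have := (ha x).symm.trans (hxy ▸ ha y)
    simpa using this
  have hsurj : Function.Surjective a := by
    intro y
    obtain ⟨x, hx⟩ := (Subgroup.mem_normalizer_iff''.1 hn _).1 (rightMul_mem_rightMulGroup y)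
    exact ⟨x, rightMul_injective hm (by rw [ha, hx]; group)⟩
  have hmul (x y : G) : a (x * y) = a x * a y := by
    apply rightMul_injective hm
    rw [ha, rightMul_mul, rightMul_mul, ha, ha]
    group
  exact ⟨MulEquiv.mk (Equiv.ofBijective a ⟨hinj, hsurj⟩) hmul, fun x => (ha x).symm⟩

theorem exists_apply_eq_of_mem_normalizer (hm : 0 < m)
    (hn : n ∈ Subgroup.normalizer (rightMulGroup m G : Set (Equiv.Perm (Fin m × G)))) :
    ∃ (π : Equiv.Perm (Fin m)) (α : G ≃* G) (g : Fin m → G),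
      ∀ i x, n (i, x) = (π i, g i * α x) := by
  obtain ⟨α, hα⟩ := exists_mulEquiv_conj_rightMul hm hn
  have apply_eq (i x) : n (i, x) = ((n (i, 1)).1, (n (i, 1)).2 * α x) := by
    have := congrArg (fun f : Equiv.Perm (Fin m × G) => f (n (i, 1))) (hα x)
    simpa using this
  have hsurj : Function.Surjective fun i => (n (i, 1)).1 := by
    intro j
    obtain ⟨⟨i, x⟩, hv⟩ := n.surjective (j, 1)
    rw [apply_eq] at hv
    exact ⟨i, congrArg Prod.fst hv⟩
  exact ⟨Equiv.ofBijective _ (Finite.injective_iff_bijective.1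
    (Finite.injective_iff_surjective.2 hsurj)), α, fun i => (n (i, 1)).2, apply_eq⟩

theorem mem_normalizer_of_closure_eq_top [Finite G] {s : Set G} (hs : Subgroup.closure s = ⊤)
    (hn : ∀ x ∈ s, n⁻¹ * rightMul m x * n ∈ rightMulGroup m G) :
    n ∈ Subgroup.normalizer (rightMulGroup m G : Set (Equiv.Perm (Fin m × G))) := by
  have conj_mem (x : G) : n⁻¹ * rightMul m x * n ∈ rightMulGroup m G := by
    induction (hs ▸ Subgroup.mem_top x : x ∈ Subgroup.closure s) using
      Subgroup.closure_induction with
    | mem x hx => exact hn x hx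
    | one => simp [rightMul_one, one_mem]
    | mul x y _ _ hx hy =>
      have : n⁻¹ * rightMul m (x * y) * n =
          (n⁻¹ * rightMul m y * n) * (n⁻¹ * rightMul m x * n) := by
        rw [rightMul_mul]; group
      exact this ▸ mul_mem hy hx
    | inv x _ hx =>
      have : n⁻¹ * rightMul m x⁻¹ * n = (n⁻¹ * rightMul m x * n)⁻¹ := by
        rw [rightMul_inv]; group
      exact this ▸ inv_mem hx
  have : Finite (rightMulGroup m G : Set (Equiv.Perm (Fin m × G))) :=
    inferInstanceAs (Finite (Set.range (rightMul m)))
  rw [← inv_mem_iff]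
  refine Subgroup.mem_normalizer_fintype ?_
  rintro _ ⟨x, rfl⟩
  simpa using conj_mem x

end Normalizer

/-! ### Equivalence of connection sets -/

section Equivalence

variable {k : ℕ} {H : Type*} [Group H] {S T : Fin k → Fin k → Set H}

/-- Two families of connection sets are fibre equivalent if permutations of the single copies of
the group form an isomorphism between their Cayley digraphs. -/
def FiberEquivalent (S T : Fin k → Fin k → Set H) : Prop :=
  ∃ φ : Fin k → Equiv.Perm H, ∀ i j x y, y * x⁻¹ ∈ S i j ↔ φ j y * (φ i x)⁻¹ ∈ T i j

/-- Two families of connection sets are affinely equivalent if a permutation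
`(i, x) ↦ (π i, g i * α x)` with `α` an automorphism of the group is an isomorphism between their
Cayley digraphs. These permutations make up the normalizer of the right multiplications. -/
def AffineEquivalent (S T : Fin k → Fin k → Set H) : Prop :=
  ∃ (π : Equiv.Perm (Fin k)) (α : H ≃* H) (g : Fin k → H),
    ∀ i j s, s ∈ S i j ↔ g j * α s * (g i)⁻¹ ∈ T (π i) (π j)

theorem FiberEquivalent.pIsomorphic (h : FiberEquivalent S T) :
    PIsomorphic (cay S) (cay T) := by
  obtain ⟨φ, hφ⟩ := h
  let σ : Equiv.Perm (Fin k × H) :=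
    ⟨fun v => (v.1, φ v.1 v.2), fun v => (v.1, (φ v.1).symm v.2), fun _ => by simp,
      fun _ => by simp⟩
  refine ⟨σ, fun u v => ?_, fun i => ⟨i, ?_⟩⟩
  · rw [cay_adj_iff, cay_adj_iff, hφ]
    rfl
  · rw [σ.image_eq_preimage_symm]
    rfl

theorem IsPCI.affineEquivalent (h : IsPCI (cay S)) (hk : 0 < k) (hT : ∀ i, T i i = ∅)
    (hST : PIsomorphic (cay S) (cay T)) : AffineEquivalent S T := by
  obtain ⟨n, hn, himage⟩ := h _ ⟨T, hT, rfl⟩ hST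
  obtain ⟨π, α, g, happly⟩ := exists_apply_eq_of_mem_normalizer hk hn
  refine ⟨π, α, g, fun i j s => ?_⟩
  have := image_adj_apply (cay S) n (i, 1) (j, s)
  rw [himage, cay_adj_iff, cay_adj_iff, happly, happly] at this
  simpa using this.symm

theorem ncard_eq_of_mem_iff_mul_mul_mem {A B : Set H} {α : H ≃* H} {a b : H}
    (h : ∀ s, s ∈ A ↔ a * α s * b ∈ B) : B.ncard = A.ncard := by
  let f : H ≃ H := (α.toEquiv.trans (Equiv.mulLeft a)).trans (Equiv.mulRight b)
  have hA : A = f ⁻¹' B := Set.ext h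
  rw [hA, ← Equiv.image_symm_eq_preimage, Set.ncard_image_of_injective _ f.symm.injective]

end Equivalence

section Pad

variable {k : ℕ} {H : Type*} {S T : Fin k → Fin k → Set H}

/-- The extension by empty connection sets of a family indexed by `k` copies of `H` to a family
indexed by `m` copies: the remaining copies consist of isolated vertices. -/
def pad (m : ℕ) (S : Fin k → Fin k → Set H) : Fin m → Fin m → Set H :=
  fun i j => {s | ∃ (hi : i.1 < k) (hj : j.1 < k), s ∈ S ⟨i, hi⟩ ⟨j, hj⟩}

theorem mem_pad {i j : Fin m} {s : H} :
    s ∈ pad m S i j ↔ ∃ (hi : i.1 < k) (hj : j.1 < k), s ∈ S ⟨i, hi⟩ ⟨j, hj⟩ := Iff.rfl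

theorem pad_castLE (hkm : k ≤ m) (i j : Fin k) :
    pad m S (Fin.castLE hkm i) (Fin.castLE hkm j) = S i j := by
  ext s
  simp [mem_pad]

theorem pad_self (hS : ∀ i, S i i = ∅) (i : Fin m) : pad m S i i = ∅ := by
  ext s
  simp [mem_pad, hS]

theorem inv_mem_pad [Group H] (hS : ∀ i j, ∀ s ∈ S i j, s⁻¹ ∈ S j i) (i j : Fin m) :
    ∀ s ∈ pad m S i j, s⁻¹ ∈ pad m S j i := by
  rintro s ⟨hi, hj, hs⟩
  exact ⟨hj, hi, hS _ _ s hs⟩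

theorem FiberEquivalent.pad [Group H] (m : ℕ) (h : FiberEquivalent S T) :
    FiberEquivalent (pad m S) (pad m T) := by
  obtain ⟨φ, hφ⟩ := h
  refine ⟨fun i => if hi : i.1 < k then φ ⟨i, hi⟩ else 1, fun i j x y => ?_⟩
  refine exists_congr fun hi => exists_congr fun hj => ?_
  simpa only [hi, hj, dite_true] using hφ ⟨i, hi⟩ ⟨j, hj⟩ x y

theorem AffineEquivalent.of_pad [Group H] (hkm : k ≤ m) (hS : ∀ i, ∃ j, (S i j).Nonempty)
    (h : AffineEquivalent (pad m S) (pad m T)) : AffineEquivalent S T := by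
  obtain ⟨π, α, g, hST⟩ := h
  have hπ (i : Fin k) : (π (Fin.castLE hkm i)).1 < k := by
    obtain ⟨j, s, hs⟩ := hS i
    rw [← pad_castLE (S := S) hkm, hST] at hs
    exact hs.1
  have hinj : Function.Injective fun i => (⟨π (Fin.castLE hkm i), hπ i⟩ : Fin k) := fun i j hij =>
    Fin.castLE_injective hkm (π.injective (Fin.ext (Fin.mk.inj_iff.1 hij)))
  refine ⟨Equiv.ofBijective _ (Finite.injective_iff_bijective.1 hinj), α,
    fun i => g (Fin.castLE hkm i), fun i j s => ?_⟩
  rw [← pad_castLE (S := S) hkm, hST, mem_pad]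
  exact ⟨fun h => h.2.2, fun h => ⟨_, _, h⟩⟩

end Pad

section Image

variable {k : ℕ} {H : Type*} [Group H] {ι : H →* G}

theorem exists_coset_coordinates (hι : Function.Injective ι) :
    ∃ (Q : Set G) (e : G ≃ H × Q), ∀ (A : Set H) x y,
      y * x⁻¹ ∈ ι '' A ↔ (e y).2 = (e x).2 ∧ (e y).1 * (e x).1⁻¹ ∈ A := by
  obtain ⟨Q, hQ, -⟩ := ι.range.exists_isComplement_right 1
  let e₁ := MonoidHom.ofInjective hι
  let e : G ≃ H × Q := hQ.equiv.trans (Equiv.prodCongr e₁.symm.toEquiv (Equiv.refl Q))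
  have he (h : H) (x : G) : e (ι h * x) = (h * (e x).1, (e x).2) := by
    have := hQ.equiv_mul_left (e₁ h) x
    change Prod.map e₁.symm id (hQ.equiv (e₁ h * x)) = _
    rw [this, Prod.map_apply, map_mul, e₁.symm_apply_apply]
    rfl
  refine ⟨Q, e, fun A x y => ⟨?_, fun h => ⟨_, h.2, ?_⟩⟩⟩
  · rintro ⟨a, ha, hxy⟩
    rw [eq_mul_inv_iff_mul_eq] at hxy
    simpa [← hxy, he] using ha
  · rw [eq_mul_inv_iff_mul_eq]
    apply e.injective
    rw [he, inv_mul_cancel_right, ← h.1]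

theorem FiberEquivalent.image (hι : Function.Injective ι) {S T : Fin k → Fin k → Set H}
    (h : FiberEquivalent S T) :
    FiberEquivalent (fun i j => ι '' S i j) (fun i j => ι '' T i j) := by
  obtain ⟨φ, hφ⟩ := h
  obtain ⟨Q, e, he⟩ := exists_coset_coordinates hι
  refine ⟨fun i => (e.trans (Equiv.prodCongr (φ i) (Equiv.refl Q))).trans e.symm,
    fun i j x y => ?_⟩
  simp only [he, hφ i j, Equiv.trans_apply, Equiv.apply_symm_apply, Equiv.prodCongr_apply,
    Prod.map_fst, Prod.map_snd, Equiv.refl_apply]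

theorem exists_mulEquiv_of_apply_mem_range [Finite H] (hι : Function.Injective ι) {β : G ≃* G}
    (hβ : ∀ s, β (ι s) ∈ ι.range) : ∃ γ : H ≃* H, ∀ s, ι (γ s) = β (ι s) := by
  let γ : H →* H := (MonoidHom.ofInjective hι).symm.toMonoidHom.comp
    ((β.toMonoidHom.comp ι).codRestrict ι.range hβ)
  have hγ (s) : ι (γ s) = β (ι s) :=
    congrArg Subtype.val ((MonoidHom.ofInjective hι).apply_symm_apply _)
  have hinj : Function.Injective γ := fun s t hst =>
    hι (β.injective (by rw [← hγ, ← hγ, hst]))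
  exact ⟨MulEquiv.ofBijective γ (Finite.injective_iff_bijective.1 hinj), hγ⟩

/-- A family of connection sets is spanned if every copy of the group has an outgoing arc, the
arcs with label `1` contain a spanning tree rooted at the copy `0`, and all labels together
generate the group. The Cayley digraph is then connected, and affine maps out of it are
determined up to inner automorphisms by their restrictions to one copy. -/
structure IsSpanned (S : Fin (k + 1) → Fin (k + 1) → Set H) : Prop where
  nonempty : ∀ i, ∃ j, (S i j).Nonempty
  one_mem : ∀ i ≠ 0, ∃ j < i, 1 ∈ S j i
  closure_eq_top : Subgroup.closure (⋃ i, ⋃ j, S i j) = ⊤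

theorem mul_inv_mem_of_forall_exists_lt {K : Subgroup G} {g : Fin (k + 1) → G}
    (hg : ∀ i ≠ 0, ∃ j < i, g i * (g j)⁻¹ ∈ K) (i : Fin (k + 1)) : g i * (g 0)⁻¹ ∈ K := by
  induction i using WellFoundedLT.induction with
  | _ i ih =>
    by_cases hi : i = 0
    · simp [hi]
    · obtain ⟨j, hj, hij⟩ := hg i hi
      simpa using mul_mem hij (ih j hj)

variable {S T : Fin (k + 1) → Fin (k + 1) → Set H}

theorem AffineEquivalent.of_image [Finite H] (hι : Function.Injective ι) (hS : IsSpanned S)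
    (h : AffineEquivalent (fun i j => ι '' S i j) (fun i j => ι '' T i j)) :
    AffineEquivalent S T := by
  obtain ⟨π, α, g, hST⟩ := h
  have mem_range {i j s} (hs : s ∈ S i j) : g j * α (ι s) * (g i)⁻¹ ∈ ι.range :=
    Set.image_subset_range _ _ ((hST i j _).1 ⟨s, hs, rfl⟩)
  have hg : ∀ i, g i * (g 0)⁻¹ ∈ ι.range := mul_inv_mem_of_forall_exists_lt fun i hi => by
    obtain ⟨j, hj, hs⟩ := hS.one_mem i hi
    exact ⟨j, hj, by simpa using mem_range hs⟩
  let β : G ≃* G := α.trans (MulAut.conj (g 0))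
  have hβ (x) : β x = g 0 * α x * (g 0)⁻¹ := rfl
  have hle : (⊤ : Subgroup H) ≤ ι.range.comap (β.toMonoidHom.comp ι) := by
    rw [← hS.closure_eq_top, Subgroup.closure_le]
    simp only [Set.iUnion_subset_iff]
    intro i j s hs
    have : β (ι s) = (g j * (g 0)⁻¹)⁻¹ * (g j * α (ι s) * (g i)⁻¹) * (g i * (g 0)⁻¹) := by
      rw [hβ]; group
    change β (ι s) ∈ ι.range
    exact this ▸ mul_mem (mul_mem (inv_mem (hg j)) (mem_range hs)) (hg i)
  obtain ⟨γ, hγ⟩ := exists_mulEquiv_of_apply_mem_range hι (β := β)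
    fun s => hle (Subgroup.mem_top s)
  choose t ht using hg
  refine ⟨π, γ, t, fun i j s => ?_⟩
  rw [← hι.mem_set_image, hST, ← hι.mem_set_image (s := T _ _), map_mul, map_mul, map_inv, ht, ht,
    hγ, hβ]
  group

theorem IsSpanned.affineEquivalent [Finite H] (hS : IsSpanned S) (hkm : k + 1 ≤ m)
    (hι : Function.Injective ι) (hT : ∀ i, T i i = ∅) (hST : FiberEquivalent S T)
    (h : IsPCI (cay (pad m fun i j => ι '' S i j))) : AffineEquivalent S T :=
  .of_image hι hS <| .of_pad hkm (fun i => (hS.nonempty i).imp fun _ hj => hj.image ι) <|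
    h.affineEquivalent (by omega) (pad_self fun i => by rw [hT, Set.image_empty])
      ((hST.image hι).pad m).pIsomorphic

theorem IsSpanned.not_isPDCIGroup [Finite H] (hS : IsSpanned S) (hkm : k + 1 ≤ m)
    (hι : Function.Injective ι) (hS_self : ∀ i, S i i = ∅) (hT_self : ∀ i, T i i = ∅)
    (hST : FiberEquivalent S T) (hne : ¬ AffineEquivalent S T) : ¬ IsPDCIGroup m G := fun h =>
  hne <| hS.affineEquivalent hkm hι hT_self hST <|
    h _ ⟨_, pad_self fun i => by rw [hS_self, Set.image_empty], rfl⟩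

theorem IsSpanned.not_isPCIGroup [Finite H] (hS : IsSpanned S) (hkm : k + 1 ≤ m)
    (hι : Function.Injective ι) (hS_self : ∀ i, S i i = ∅)
    (hS_inv : ∀ i j, ∀ s ∈ S i j, s⁻¹ ∈ S j i) (hT_self : ∀ i, T i i = ∅)
    (hST : FiberEquivalent S T) (hne : ¬ AffineEquivalent S T) : ¬ IsPCIGroup m G := fun h =>
  hne <| hS.affineEquivalent hkm hι hT_self hST <|
    h _ ⟨⟨_, pad_self fun i => by rw [hS_self, Set.image_empty], rfl⟩,
      isGraph_cay <| inv_mem_pad fun i j => by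
        rintro _ ⟨s, hs, rfl⟩
        exact ⟨s⁻¹, hS_inv i j s hs, map_inv ι s⟩⟩

end Image

/-! ### Groups that are not `m`PCI -/

section Square

open scoped Pointwise

variable {H : Type*} [CommGroup H]

/-- Connection sets on four copies of `H` that form a square: two opposite sides carry the labels
`A` and `X`, the other two both carry the label `C`. -/
def squareSets (C : Subgroup H) (A X : Set H) : Fin 4 → Fin 4 → Set H
  | 0, 1 => A
  | 1, 0 => A⁻¹
  | 2, 3 => X
  | 3, 2 => X⁻¹
  | 0, 2 => C
  | 2, 0 => C
  | 1, 3 => C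
  | 3, 1 => C
  | _, _ => ∅

variable {C : Subgroup H} {A B X : Set H}

theorem squareSets_self (i : Fin 4) : squareSets C A X i i = ∅ := by
  fin_cases i <;> rfl

theorem inv_mem_squareSets (i j : Fin 4) : ∀ s ∈ squareSets C A X i j,
    s⁻¹ ∈ squareSets C A X j i := by
  fin_cases i <;> fin_cases j <;> simp [squareSets]

theorem eq_of_squareSets_nonempty {i j : Fin 4} (h : (squareSets C A X i j).Nonempty) :
    j = ![1, 0, 3, 2] i ∨ j = ![2, 3, 0, 1] i ∧ squareSets C A X i j = C := by
  fin_cases i <;> fin_cases j <;> simp_all [squareSets]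

theorem isSpanned_squareSets (hA : 1 ∈ A) (hgen : Subgroup.closure (A ∪ C) = ⊤) :
    IsSpanned (squareSets C A X) where
  nonempty i := by
    fin_cases i
    exacts [⟨2, 1, C.one_mem⟩, ⟨3, 1, C.one_mem⟩, ⟨0, 1, C.one_mem⟩, ⟨1, 1, C.one_mem⟩]
  one_mem i hi := by
    fin_cases i
    exacts [absurd rfl hi, ⟨0, by decide, hA⟩, ⟨0, by decide, C.one_mem⟩,
      ⟨1, by decide, C.one_mem⟩]
  closure_eq_top := by
    rw [eq_top_iff, ← hgen]
    refine Subgroup.closure_mono (Set.union_subset ?_ ?_)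
    · exact fun s hs => Set.mem_iUnion₂.2 ⟨0, 1, hs⟩
    · exact fun s hs => Set.mem_iUnion₂.2 ⟨0, 2, hs⟩

theorem fiberEquivalent_squareSets (φ ψ : Equiv.Perm H)
    (hAB : ∀ x y, y * x⁻¹ ∈ A ↔ ψ y * (φ x)⁻¹ ∈ B)
    (hφ : ∀ x, φ x * x⁻¹ ∈ C) (hψ : ∀ x, ψ x * x⁻¹ ∈ C) :
    FiberEquivalent (squareSets C A A) (squareSets C A B) := by
  have apply_mul_mem {θ : Equiv.Perm H} (hθ : ∀ x, θ x * x⁻¹ ∈ C) (x y : H) :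
      y * x⁻¹ ∈ C ↔ θ y * x⁻¹ ∈ C := by
    rw [← C.mul_mem_cancel_left (hθ y)]
    group
  have mul_apply_mem {θ : Equiv.Perm H} (hθ : ∀ x, θ x * x⁻¹ ∈ C) (x y : H) :
      y * x⁻¹ ∈ C ↔ y * (θ x)⁻¹ ∈ C := by
    rw [← C.mul_mem_cancel_right (hθ x) (y := y * (θ x)⁻¹)]
    group
  refine ⟨![1, 1, φ, ψ], fun i j x y => ?_⟩
  fin_cases i <;> fin_cases j <;> first
    | exact Iff.rfl
    | exact apply_mul_mem hφ x y
    | exact mul_apply_mem hφ x y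
    | exact apply_mul_mem hψ x y
    | exact mul_apply_mem hψ x y
    | exact hAB x y
    | simpa [squareSets] using hAB y x

theorem exists_mul_mem_iff_of_square {p : Fin 4} {c : H} (hc : c ∈ C)
    (h : ∀ t, t ∈ squareSets C A B p (![1, 0, 3, 2] p) ↔
      c * t ∈ squareSets C A B (![2, 3, 0, 1] p) (![3, 2, 1, 0] p)) :
    ∃ c ∈ C, ∀ t, t ∈ A ↔ c * t ∈ B := by
  have hc' := inv_mem hc
  fin_cases p
  · exact ⟨c, hc, h⟩
  · exact ⟨c⁻¹, hc', fun t => by simpa [squareSets, mul_comm] using h t⁻¹⟩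
  · exact ⟨c⁻¹, hc', fun t => by simpa [squareSets] using (h (c⁻¹ * t)).symm⟩
  · exact ⟨c, hc, fun t => by simpa [squareSets, mul_comm] using (h (c⁻¹ * t⁻¹)).symm⟩

/-- The sides labelled `A` are mapped to the sides labelled `A` and `B`, possibly with both
directions reversed. Comparing the translation parts along the two paths from the first copy to
the last one shows that they differ by an element of `C`. -/
theorem AffineEquivalent.exists_mul_mem_iff
    (h : AffineEquivalent (squareSets C A A) (squareSets C A B)) (hA : 1 ∈ A)
    (hAC : ∀ (α : H ≃* H) (g : H), ¬ ∀ s, s ∈ A ↔ g * α s ∈ C) :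
    ∃ c ∈ C, ∀ t, t ∈ A ↔ c * t ∈ B := by
  obtain ⟨π, α, g, h⟩ := h
  have hdiv (i j : Fin 4) (s : H) : s ∈ squareSets C A A i j ↔
      g j / g i * α s ∈ squareSets C A B (π i) (π j) := by
    rw [h, mul_right_comm, div_eq_mul_inv]
  have side_A {i j : Fin 4} (hij : squareSets C A A i j = A) : π j = ![1, 0, 3, 2] (π i) := by
    have hne : (squareSets C A B (π i) (π j)).Nonempty := ⟨_, (hdiv i j 1).1 (hij.symm ▸ hA)⟩
    refine (eq_of_squareSets_nonempty hne).resolve_right fun ⟨_, hC⟩ => ?_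
    exact hAC α (g j / g i) fun s => by simpa only [hij, hC, SetLike.mem_coe] using hdiv i j s
  have label_mem {i j : Fin 4} (hij : 1 ∈ squareSets C A A i j) :
      g j / g i ∈ squareSets C A B (π i) (π j) := by
    simpa using (hdiv i j 1).1 hij
  have h02 := label_mem (i := 0) (j := 2) C.one_mem
  have h13 := label_mem (i := 1) (j := 3) C.one_mem
  have h1 : π 1 = ![1, 0, 3, 2] (π 0) := side_A rfl
  have h3 : π 3 = ![1, 0, 3, 2] (π 2) := side_A rfl
  have h2 : π 2 = ![2, 3, 0, 1] (π 0) :=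
    ((eq_of_squareSets_nonempty ⟨_, h02⟩).resolve_left fun h2 =>
      π.injective.ne (by decide : (2 : Fin 4) ≠ 1) (h2.trans h1.symm)).1
  have hC (p : Fin 4) : squareSets C A B p (![2, 3, 0, 1] p) = C ∧
      squareSets C A B (![1, 0, 3, 2] p) (![1, 0, 3, 2] (![2, 3, 0, 1] p : Fin 4)) = C ∧
      (![1, 0, 3, 2] (![2, 3, 0, 1] p : Fin 4) : Fin 4) = ![3, 2, 1, 0] p := by
    fin_cases p <;> exact ⟨rfl, rfl, rfl⟩
  rw [h2, (hC _).1] at h02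
  rw [h3, h2, h1, (hC _).2.1] at h13
  refine exists_mul_mem_iff_of_square (p := π 0)
    (c := (g 3 / g 2) / (g 1 / g 0)) ?_ fun t => ?_
  · rw [div_div_div_comm]
    exact div_mem h13 h02
  · obtain ⟨s, hs⟩ := α.surjective (t / (g 1 / g 0))
    have h01 := hdiv 0 1 s
    have h23 := hdiv 2 3 s
    rw [h1, hs, mul_div_cancel] at h01
    rw [h3, h2, (hC _).2.2, hs, mul_div_left_comm, mul_comm t] at h23
    exact h01.symm.trans h23

theorem not_isPCIGroup_of_square [Finite H] (hm : 4 ≤ m) {ι : H →* G}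
    (hι : Function.Injective ι) (φ ψ : Equiv.Perm H)
    (hAB : ∀ x y, y * x⁻¹ ∈ A ↔ ψ y * (φ x)⁻¹ ∈ B)
    (hφ : ∀ x, φ x * x⁻¹ ∈ C) (hψ : ∀ x, ψ x * x⁻¹ ∈ C) (hA : 1 ∈ A)
    (hgen : Subgroup.closure (A ∪ C) = ⊤)
    (hAC : ∀ (α : H ≃* H) (g : H), ¬ ∀ s, s ∈ A ↔ g * α s ∈ C)
    (hne : ∀ c ∈ C, ¬ ∀ s, s ∈ A ↔ c * s ∈ B) : ¬ IsPCIGroup m G := by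
  refine (isSpanned_squareSets hA hgen).not_isPCIGroup hm hι squareSets_self inv_mem_squareSets
    squareSets_self (fiberEquivalent_squareSets φ ψ hAB hφ hψ) fun h => ?_
  obtain ⟨c, hc, hcAB⟩ := h.exists_mul_mem_iff hA hAC
  exact hne c hc hcAB

end Square

theorem not_isPCIGroup_of_perm_mul_left {H : Type*} [CommGroup H] [Finite H] (hm : 4 ≤ m)
    {ι : H →* G} (hι : Function.Injective ι) {a b : H} (φ : Equiv.Perm H)
    (hφ : ∀ x, φ (a * x) = b * φ x) (ha : a ≠ 1) (hab : b ≠ a) (hab' : b ≠ a⁻¹) :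
    ¬ IsPCIGroup m G := by
  have hb : b ≠ 1 := by
    rintro rfl
    exact ha (by simpa using hφ 1)
  refine not_isPCIGroup_of_square (C := ⊤) (A := {1, a}) (B := {1, b}) hm hι φ φ ?_
    (fun _ => Subgroup.mem_top _) (fun _ => Subgroup.mem_top _) (by simp) ?_ ?_ ?_
  · intro x y
    simp only [Set.mem_insert_iff, Set.mem_singleton_iff, one_mul, mul_inv_eq_iff_eq_mul,
      ← hφ, φ.injective.eq_iff]
  · rw [Subgroup.coe_top, Set.union_univ, Subgroup.closure_univ]
  · intro α g h
    simpa [hb, hab] using (h b).2 (Subgroup.mem_top _)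
  · intro c _ h
    have h1 : c = 1 ∨ c = b := by simpa using (h 1).1 (by simp)
    have h2 : c * a = 1 ∨ c * a = b := (h a).1 (by simp)
    rcases h1 with rfl | rfl
    · rw [one_mul] at h2
      exact h2.elim ha hab.symm
    · exact h2.elim (fun h2 => hab' (eq_inv_of_mul_eq_one_left h2))
        fun h2 => ha (by simpa using h2)

theorem exists_zmod_hom_of_orderOf_eq {n : ℕ} {g : G} (hg : orderOf g = n) :
    ∃ ι : Multiplicative (ZMod n) →* G, Function.Injective ι ∧ ι (ofAdd 1) = g := by
  let a : Subgroup.zpowers g := ⟨g, Subgroup.mem_zpowers g⟩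
  have ha (x) : x ∈ Subgroup.zpowers a := by
    obtain ⟨_, k, rfl⟩ := x
    exact ⟨k, rfl⟩
  have hcard : Nat.card (Subgroup.zpowers g) = n := (Nat.card_zpowers g).trans hg
  exact ⟨(Subgroup.zpowers g).subtype.comp (zmodMulEquivOfGenerator ha hcard).toMonoidHom,
    (Subgroup.subtype_injective _).comp (zmodMulEquivOfGenerator ha hcard).injective,
    congrArg Subtype.val (zmodMulEquivOfGenerator_apply_ofAdd_one ha hcard)⟩

theorem not_isPCIGroup_of_odd_orderOf (hm : 4 ≤ m) {g : G} (h5 : 5 ≤ orderOf g)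
    (hodd : Odd (orderOf g)) : ¬ IsPCIGroup m G := by
  obtain ⟨ι, hι, hι1⟩ := exists_zmod_hom_of_orderOf_eq (g := g) rfl
  have : NeZero (orderOf g) := ⟨by omega⟩
  have hcop : (Nat.card (Multiplicative (ZMod (orderOf g)))).Coprime 2 := by
    rw [Nat.card_eq_of_bijective _ Multiplicative.toAdd.bijective, Nat.card_zmod]
    exact hodd.coprime_two_right
  have pow_ne {k : ℕ} (hk : k ≠ 0) (hk5 : k < 5) :
      (ofAdd 1 : Multiplicative (ZMod (orderOf g))) ^ k ≠ 1 := fun h =>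
    pow_ne_one_of_lt_orderOf hk (hk5.trans_le h5) (by rw [← hι1, ← map_pow, h, map_one])
  refine not_isPCIGroup_of_perm_mul_left hm hι (a := ofAdd 1) (b := ofAdd 1 ^ 2)
    (powCoprime hcop) (fun x => mul_pow _ x 2) ?_ ?_ ?_
  · simpa using pow_ne (k := 1)
  · intro h
    exact pow_ne (k := 1) (by norm_num) (by norm_num) (by simpa [pow_two] using h)
  · intro h
    refine pow_ne (k := 3) (by norm_num) (by norm_num) ?_
    rw [pow_succ, h, inv_mul_cancel]

section MulLeft

variable {H : Type*} [Group H] {p : ℕ}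

theorem cycleType_mulLeft_of_orderOf_eq_prime [Fintype H] [DecidableEq H] (hp : p.Prime) {a : H}
    (ha : orderOf a = p) : (Equiv.mulLeft a).cycleType =
      Multiset.replicate (Fintype.card H / p) p := by
  have := Fact.mk hp
  have hpow : Equiv.mulLeft a ^ p = 1 := by
    rw [← ha, Equiv.pow_mulLeft, pow_orderOf_eq_one, Equiv.mulLeft_one]
  have hsupport : (Equiv.mulLeft a).support = Finset.univ := by
    ext x
    have : a ≠ 1 := fun h => hp.one_lt.ne (by rw [← ha, h, orderOf_one])
    simpa using this
  have hreplicate := Equiv.Perm.cycleType_of_pow_prime_eq_one hpow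
  have hsum := (Equiv.mulLeft a).sum_cycleType
  rw [hreplicate, hsupport, Multiset.sum_replicate, Finset.card_univ, smul_eq_mul] at hsum
  rw [← hsum, Nat.mul_div_cancel _ hp.pos, ← hreplicate]

theorem exists_perm_mul_left [Finite H] (hp : p.Prime) {a b : H} (ha : orderOf a = p)
    (hb : orderOf b = p) : ∃ φ : Equiv.Perm H, ∀ x, φ (a * x) = b * φ x := by
  classical
  have := Fintype.ofFinite H
  obtain ⟨φ, hφ⟩ := isConj_iff.1 <| Equiv.Perm.isConj_iff_cycleType_eq.2 <|
    (cycleType_mulLeft_of_orderOf_eq_prime hp ha).trans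
      (cycleType_mulLeft_of_orderOf_eq_prime hp hb).symm
  refine ⟨φ, fun x => ?_⟩
  simpa using congrArg (fun f : Equiv.Perm H => f (φ x)) hφ

end MulLeft

theorem orderOf_eq_prime_of_not_isCyclic {H : Type*} [Group H] {p : ℕ} (hp : p.Prime)
    (hH : Nat.card H = p ^ 2) (hcyc : ¬ IsCyclic H) {x : H} (hx : x ≠ 1) : orderOf x = p := by
  obtain ⟨k, hk, hxk⟩ := (Nat.dvd_prime_pow hp).1 (hH ▸ orderOf_dvd_natCard x)
  interval_cases k
  · exact absurd (orderOf_eq_one_iff.1 (by simpa using hxk)) hx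
  · simpa using hxk
  · have : Finite H := Nat.finite_of_card_ne_zero (by rw [hH]; exact pow_ne_zero _ hp.ne_zero)
    exact absurd (isCyclic_of_orderOf_eq_card x (hxk.trans hH.symm)) hcyc

theorem not_isPCIGroup_of_not_isCyclic (hm : 4 ≤ m) {p : ℕ} (hp : p.Prime)
    (K : Subgroup G) (hK : Nat.card K = p ^ 2) (hcyc : ¬ IsCyclic K) : ¬ IsPCIGroup m G := by
  have := Fact.mk hp
  have : Finite K := Nat.finite_of_card_ne_zero (by rw [hK]; exact pow_ne_zero _ hp.ne_zero)
  let := IsPGroup.commGroupOfCardEqPrimeSq hK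
  have orderOf_eq {x : K} : x ≠ 1 → orderOf x = p := orderOf_eq_prime_of_not_isCyclic hp hK hcyc
  have : Nontrivial K := by
    rw [← Finite.one_lt_card_iff_nontrivial, hK]
    exact Nat.one_lt_pow two_ne_zero hp.one_lt
  obtain ⟨a, ha⟩ := exists_ne (1 : K)
  obtain ⟨b, hb⟩ : ∃ b : K, b ∉ Subgroup.zpowers a := by
    by_contra! h
    exact hcyc ⟨a, h⟩
  have hb1 : b ≠ 1 := fun h => hb (h ▸ one_mem _)
  obtain ⟨φ, hφ⟩ := exists_perm_mul_left hp (orderOf_eq ha) (orderOf_eq hb1)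
  exact not_isPCIGroup_of_perm_mul_left hm (ι := K.subtype) K.subtype_injective φ hφ ha
    (fun h => hb (h ▸ Subgroup.mem_zpowers _))
    (fun h => hb (h ▸ inv_mem (Subgroup.mem_zpowers _)))

theorem zpowers_ofAdd_one (n : ℕ) : Subgroup.zpowers (ofAdd (1 : ZMod n)) = ⊤ := by
  rw [Subgroup.eq_top_iff']
  intro x
  exact ⟨(x.toAdd : ZMod n).cast, by simp [← ofAdd_zsmul]⟩

theorem closure_eq_top_of_ofAdd_one_mem {n : ℕ} {s : Set (Multiplicative (ZMod n))}
    (h : ofAdd 1 ∈ s) : Subgroup.closure s = ⊤ :=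
  eq_top_mono (Subgroup.zpowers_le.2 (Subgroup.subset_closure h)) (zpowers_ofAdd_one n)

theorem not_isPCIGroup_of_orderOf_eq_four (hm : 4 ≤ m) {g : G} (hg : orderOf g = 4) :
    ¬ IsPCIGroup m G := by
  obtain ⟨ι, hι, -⟩ := exists_zmod_hom_of_orderOf_eq hg
  have mem_ker (x : Multiplicative (ZMod 4)) : x ∈ (powMonoidHom 2).ker ↔ x ^ 2 = 1 := Iff.rfl
  refine not_isPCIGroup_of_square (C := (powMonoidHom 2).ker) (A := {1, ofAdd 1})
    (B := {1, ofAdd 3}) hm hι (Equiv.inv _) (Equiv.inv _) ?_ ?_ ?_ (by simp)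
    (closure_eq_top_of_ofAdd_one_mem (by simp)) ?_ ?_
  · simp only [Equiv.inv_apply, Set.mem_insert_iff, Set.mem_singleton_iff]
    decide
  · simp only [mem_ker, Equiv.inv_apply]
    decide
  · simp only [mem_ker, Equiv.inv_apply]
    decide
  · intro α g h
    have h1 := (h 1).1 (by simp)
    have h2 := (h (ofAdd 1)).1 (by simp)
    rw [map_one, mul_one] at h1
    rw [Subgroup.mul_mem_cancel_left _ h1, mem_ker, ← map_pow, map_eq_one_iff α α.injective] at h2
    exact absurd h2 (by decide)
  · simp only [mem_ker, Set.mem_insert_iff, Set.mem_singleton_iff]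
    decide

theorem not_isPCIGroup_of_orderOf_eq_six (hm : 4 ≤ m) {g : G} (hg : orderOf g = 6) :
    ¬ IsPCIGroup m G := by
  obtain ⟨ι, hι, -⟩ := exists_zmod_hom_of_orderOf_eq hg
  refine not_isPCIGroup_of_square (C := ⊤) (A := {1, ofAdd 1, ofAdd 3})
    (B := {1, ofAdd 5, ofAdd 3}) hm hι (Equiv.inv _) (Equiv.inv _)
    ?_ (fun _ => Subgroup.mem_top _) (fun _ => Subgroup.mem_top _) (by simp)
    (closure_eq_top_of_ofAdd_one_mem (by simp)) ?_ ?_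
  · simp only [Equiv.inv_apply, Set.mem_insert_iff, Set.mem_singleton_iff]
    decide
  · intro α g h
    have := (h (ofAdd 2)).2 (Subgroup.mem_top _)
    simp only [Set.mem_insert_iff, Set.mem_singleton_iff] at this
    exact absurd this (by decide)
  · simp only [Subgroup.mem_top, forall_const, Set.mem_insert_iff, Set.mem_singleton_iff]
    decide

section Triangle

/-- Connection sets on six copies of the cyclic group of order three that form two triangles.
Going around the first triangle multiplies by `ofAdd 1`, going around the second one, whose
connection sets are complements of single elements, multiplies by `x⁻¹`. The complete connections
between the triangles make the valencies of the six copies distinct. -/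
def triangleSets (x : Multiplicative (ZMod 3)) : Fin 6 → Fin 6 → Finset (Multiplicative (ZMod 3))
  | 0, 1 => {1}
  | 1, 0 => {1}
  | 1, 2 => {1}
  | 2, 1 => {1}
  | 0, 2 => {ofAdd 1}
  | 2, 0 => {ofAdd 2}
  | 3, 5 => {1}
  | 5, 3 => {1}
  | 4, 5 => {1}ᶜ
  | 5, 4 => {1}ᶜ
  | 3, 4 => {x}ᶜ
  | 4, 3 => {x⁻¹}ᶜ
  | 0, 3 => Finset.univ
  | 3, 0 => Finset.univ
  | 0, 4 => Finset.univ
  | 4, 0 => Finset.univ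
  | 1, 3 => Finset.univ
  | 3, 1 => Finset.univ
  | _, _ => ∅

theorem coe_triangleSets_self (x : Multiplicative (ZMod 3)) (i : Fin 6) :
    (triangleSets x i i : Set (Multiplicative (ZMod 3))) = ∅ := by
  revert x i
  simp only [Finset.coe_eq_empty]
  decide

theorem isSpanned_triangleSets (x : Multiplicative (ZMod 3)) :
    IsSpanned fun i j => (triangleSets x i j : Set (Multiplicative (ZMod 3))) where
  nonempty := by
    simp only [Finset.coe_nonempty]
    revert x
    decide
  one_mem := by
    simp only [Finset.mem_coe]
    revert x
    decide
  closure_eq_top := closure_eq_top_of_ofAdd_one_mem <|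
    Set.mem_iUnion₂.2 ⟨0, 2, Finset.mem_singleton_self _⟩

theorem fiberEquivalent_triangleSets :
    FiberEquivalent (fun i j => (triangleSets (ofAdd 1) i j : Set (Multiplicative (ZMod 3))))
      (fun i j => triangleSets (ofAdd 2) i j) := by
  refine ⟨![1, 1, 1, Equiv.inv _, Equiv.inv _, Equiv.inv _], ?_⟩
  simp only [Finset.mem_coe]
  decide

theorem eq_one_of_card_triangleSets_apply {π : Equiv.Perm (Fin 6)}
    (hπ : ∀ i j, (triangleSets (ofAdd 2) (π i) (π j)).card =
      (triangleSets (ofAdd 1) i j).card) : π = 1 := by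
  have hinj : Function.Injective fun i => ∑ j, (triangleSets (ofAdd 2) i j).card := by decide
  have hcard (i j) : (triangleSets (ofAdd 1) i j).card = (triangleSets (ofAdd 2) i j).card := by
    revert i j
    decide
  refine Equiv.ext fun i => hinj ?_
  change ∑ j, _ = ∑ j, _
  rw [← Equiv.sum_comp π]
  exact Finset.sum_congr rfl fun j _ => (hπ i j).trans (hcard i j)

theorem not_affineEquivalent_triangleSets :
    ¬ AffineEquivalent (fun i j => (triangleSets (ofAdd 1) i j : Set (Multiplicative (ZMod 3))))
      (fun i j => triangleSets (ofAdd 2) i j) := by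
  rintro ⟨π, α, g, h⟩
  have hπ : π = 1 := eq_one_of_card_triangleSets_apply fun i j => by
    rw [← Set.ncard_coe_finset, ← Set.ncard_coe_finset]
    exact ncard_eq_of_mem_iff_mul_mul_mem (h i j)
  simp only [hπ, Equiv.Perm.one_apply, Finset.mem_coe] at h
  have h01 := (h 0 1 1).1 (by decide)
  have h12 := (h 1 2 1).1 (by decide)
  have h02 := (h 0 2 (ofAdd 1)).1 (by decide)
  have h35 := (h 3 5 1).1 (by decide)
  have h45 := (h 4 5 1).not.1 (by decide)
  have h34 := (h 3 4 (ofAdd 1)).not.1 (by decide)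
  simp only [triangleSets, Finset.mem_singleton, Finset.mem_compl, not_not, map_one, mul_one,
    one_mul, mul_inv_eq_iff_eq_mul] at h01 h12 h02 h35 h45 h34
  rw [h12, h01, mul_comm, mul_right_cancel_iff] at h02
  rw [← h45, h35, mul_comm, mul_right_cancel_iff, h02] at h34
  exact absurd h34 (by decide)

theorem not_isPCIGroup_of_orderOf_eq_three (hm : 6 ≤ m) {g : G} (hg : orderOf g = 3) :
    ¬ IsPCIGroup m G := by
  obtain ⟨ι, hι, -⟩ := exists_zmod_hom_of_orderOf_eq hg
  refine (isSpanned_triangleSets (ofAdd 1)).not_isPCIGroup hm hι (coe_triangleSets_self _) ?_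
    (coe_triangleSets_self _) fiberEquivalent_triangleSets not_affineEquivalent_triangleSets
  simp only [Finset.mem_coe]
  decide

end Triangle

section Digon

/-- Connection sets on four copies of the cyclic group of order three that form two digons.
Going around them multiplies by `ofAdd 1` and by `x`, respectively. The complete connection leads
from the first digon to the second one and makes the copies distinguishable. -/
def digonSets (x : Multiplicative (ZMod 3)) : Fin 4 → Fin 4 → Finset (Multiplicative (ZMod 3))
  | 0, 1 => {1}
  | 1, 0 => {ofAdd 1}
  | 2, 3 => {1}
  | 3, 2 => {x}
  | 0, 2 => Finset.univ
  | _, _ => ∅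

theorem coe_digonSets_self (x : Multiplicative (ZMod 3)) (i : Fin 4) :
    (digonSets x i i : Set (Multiplicative (ZMod 3))) = ∅ := by
  revert x i
  simp only [Finset.coe_eq_empty]
  decide

theorem isSpanned_digonSets (x : Multiplicative (ZMod 3)) :
    IsSpanned fun i j => (digonSets x i j : Set (Multiplicative (ZMod 3))) where
  nonempty := by
    simp only [Finset.coe_nonempty]
    revert x
    decide
  one_mem := by
    simp only [Finset.mem_coe]
    revert x
    decide
  closure_eq_top := closure_eq_top_of_ofAdd_one_mem <|
    Set.mem_iUnion₂.2 ⟨1, 0, Finset.mem_singleton_self _⟩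

theorem fiberEquivalent_digonSets :
    FiberEquivalent (fun i j => (digonSets (ofAdd 1) i j : Set (Multiplicative (ZMod 3))))
      (fun i j => digonSets (ofAdd 2) i j) := by
  refine ⟨![1, 1, Equiv.inv _, Equiv.inv _], ?_⟩
  simp only [Finset.mem_coe]
  decide

theorem eq_of_digonSets_nonempty : ∀ a b c d : Fin 4, (digonSets (ofAdd 2) a b).Nonempty ∧
    (digonSets (ofAdd 2) b a).Nonempty ∧ (digonSets (ofAdd 2) c d).Nonempty ∧
    (digonSets (ofAdd 2) a c).Nonempty ∧ b ≠ c → a = 0 ∧ b = 1 ∧ c = 2 ∧ d = 3 := by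
  decide

theorem not_affineEquivalent_digonSets :
    ¬ AffineEquivalent (fun i j => (digonSets (ofAdd 1) i j : Set (Multiplicative (ZMod 3))))
      (fun i j => digonSets (ofAdd 2) i j) := by
  rintro ⟨π, α, g, h⟩
  simp only [Finset.mem_coe] at h
  have h01 := (h 0 1 1).1 (by decide)
  have h10 := (h 1 0 (ofAdd 1)).1 (by decide)
  have h23 := (h 2 3 1).1 (by decide)
  have h32 := (h 3 2 (ofAdd 1)).1 (by decide)
  have h02 := (h 0 2 1).1 (by decide)
  obtain ⟨e0, e1, e2, e3⟩ := eq_of_digonSets_nonempty _ _ _ _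
    ⟨⟨_, h01⟩, ⟨_, h10⟩, ⟨_, h23⟩, ⟨_, h02⟩, π.injective.ne (by decide)⟩
  rw [e0, e1] at h01 h10
  rw [e2, e3] at h23 h32
  simp only [digonSets, Finset.mem_singleton, map_one, mul_one, one_mul,
    mul_inv_eq_iff_eq_mul] at h01 h10 h23 h32
  rw [h01, mul_comm, mul_right_cancel_iff] at h10
  rw [h23, mul_comm, mul_right_cancel_iff, h10] at h32
  exact absurd h32 (by decide)

theorem not_isPDCIGroup_of_orderOf_eq_three (hm : 4 ≤ m) {g : G} (hg : orderOf g = 3) :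
    ¬ IsPDCIGroup m G := by
  obtain ⟨ι, hι, -⟩ := exists_zmod_hom_of_orderOf_eq hg
  exact (isSpanned_digonSets (ofAdd 1)).not_isPDCIGroup hm hι (coe_digonSets_self _)
    (coe_digonSets_self _) fiberEquivalent_digonSets not_affineEquivalent_digonSets

end Digon

/-! ### Necessary conditions -/

section DihedralGroup

variable {n : ℕ}

/-- The homomorphism from the dihedral group to `G` that maps the rotations by `ζ` and the
reflection `sr 0` to an involution `b` inverting the image of `ζ`. -/
def dihedralLift (ζ : Multiplicative (ZMod n) →* G) (b : G) (hb : b * b = 1)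
    (hζ : ∀ x, ζ x * b = b * (ζ x)⁻¹) : DihedralGroup n →* G :=
  MonoidHom.mk' (fun
    | .r i => ζ (ofAdd i)
    | .sr i => b * ζ (ofAdd i)) <| by
  have map_add (i j : ZMod n) : ζ (ofAdd (i + j)) = ζ (ofAdd i) * ζ (ofAdd j) := map_mul ζ _ _
  have map_sub (i j : ZMod n) : ζ (ofAdd (j - i)) = (ζ (ofAdd i))⁻¹ * ζ (ofAdd j) := by
    rw [sub_eq_neg_add, map_add, ofAdd_neg, map_inv]
  rintro (i | i) (j | j)
  · exact map_add i j
  · change b * ζ (ofAdd (j - i)) = ζ (ofAdd i) * (b * ζ (ofAdd j))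
    rw [map_sub, ← mul_assoc, ← hζ, mul_assoc]
  · change b * ζ (ofAdd (i + j)) = b * ζ (ofAdd i) * ζ (ofAdd j)
    rw [map_add, mul_assoc]
  · change ζ (ofAdd (j - i)) = b * ζ (ofAdd i) * (b * ζ (ofAdd j))
    rw [map_sub, mul_assoc, ← mul_assoc (ζ _) b, hζ, ← mul_assoc b, ← mul_assoc b, hb, one_mul]

theorem dihedralLift_injective {ζ : Multiplicative (ZMod n) →* G} {b : G} (hb : b * b = 1)
    (hζ : ∀ x, ζ x * b = b * (ζ x)⁻¹) (hinj : Function.Injective ζ) (hbζ : b ∉ ζ.range) :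
    Function.Injective (dihedralLift ζ b hb hζ) := by
  rw [injective_iff_map_eq_one]
  rintro (i | i) h
  · change ζ (ofAdd i) = 1 at h
    rw [map_eq_one_iff ζ hinj, ofAdd_eq_one] at h
    rw [h, DihedralGroup.r_zero]
  · change b * ζ (ofAdd i) = 1 at h
    exact absurd ⟨(ofAdd i)⁻¹, by rw [map_inv, eq_inv_of_mul_eq_one_left h]⟩ hbζ

theorem eq_or_eq_or_eq_inv_of_mem_zpowers {a x : G} (ha : a ^ 3 = 1)
    (hx : x ∈ Subgroup.zpowers a) : x = 1 ∨ x = a ∨ x = a⁻¹ := by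
  obtain ⟨k, rfl⟩ := hx
  have ha' : a ^ (3 : ℤ) = 1 := mod_cast ha
  have hk : a ^ k = a ^ (k % 3) := zpow_eq_zpow_emod k ha'
  have h2 : a ^ (2 : ℤ) = a⁻¹ := by
    rw [eq_inv_iff_mul_eq_one, ← zpow_add_one]
    exact ha'
  change a ^ k = _ ∨ a ^ k = _ ∨ a ^ k = _
  have : k % 3 = 0 ∨ k % 3 = 1 ∨ k % 3 = 2 := by omega
  rcases this with h | h | h <;> simp [hk, h, h2]

theorem conj_eq_inv_of_orderOf_ne_six {a b : G} (ha : orderOf a = 3) (hb : orderOf b = 2)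
    (hnormal : (Subgroup.zpowers a).Normal) (h6 : orderOf (b * a) ≠ 6) : b * a * b⁻¹ = a⁻¹ := by
  have ha1 : a ≠ 1 := fun h => by simp [h] at ha
  rcases eq_or_eq_or_eq_inv_of_mem_zpowers (ha ▸ pow_orderOf_eq_one a)
    (hnormal.conj_mem _ (Subgroup.mem_zpowers a) b) with h | h | h
  · exact absurd (conj_eq_one_iff.1 h) ha1
  · have hcomm : Commute b a := mul_inv_eq_iff_eq_mul.1 h
    rw [hcomm.orderOf_mul_eq_mul_orderOf_of_coprime (by rw [ha, hb]; norm_num), ha, hb] at h6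
    exact absurd rfl h6
  · exact h

theorem conj_map_eq_inv_of_conj_map_ofAdd_one_eq_inv {ζ : Multiplicative (ZMod n) →* G} {b : G}
    (hb : b * ζ (ofAdd 1) * b⁻¹ = (ζ (ofAdd 1))⁻¹) (x : Multiplicative (ZMod n)) :
    b * ζ x * b⁻¹ = (ζ x)⁻¹ := by
  have : (MulAut.conj b).toMonoidHom.comp ζ = ζ.comp invMonoidHom :=
    MonoidHom.eq_of_eqOn_dense
      (closure_eq_top_of_ofAdd_one_mem (Set.mem_singleton (ofAdd 1))) (by simpa using hb)
  simpa using DFunLike.congr_fun this x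

theorem nonempty_mulEquiv_dihedralGroup_three [Finite G] (hG : Nat.card G = 6)
    (h6 : ∀ g : G, orderOf g ≠ 6) : Nonempty (G ≃* DihedralGroup 3) := by
  obtain ⟨a, ha⟩ := exists_prime_orderOf_dvd_card' (G := G) 3 (by rw [hG]; norm_num)
  obtain ⟨b, hb⟩ := exists_prime_orderOf_dvd_card' (G := G) 2 (by rw [hG]; norm_num)
  obtain ⟨ζ, hζ, rfl⟩ := exists_zmod_hom_of_orderOf_eq ha
  have hb2 : b * b = 1 := by rw [← pow_two, ← hb, pow_orderOf_eq_one b]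
  have hindex : (Subgroup.zpowers (ζ (ofAdd 1))).index = 2 := by
    have := (Subgroup.zpowers (ζ (ofAdd 1))).card_mul_index
    rw [Nat.card_zpowers, ha, hG] at this
    omega
  have hconj := conj_eq_inv_of_orderOf_ne_six ha hb (Subgroup.normal_of_index_eq_two hindex) (h6 _)
  have hinvert (x) : ζ x * b = b * (ζ x)⁻¹ := by
    rw [← conj_map_eq_inv_of_conj_map_ofAdd_one_eq_inv hconj x, ← mul_assoc, ← mul_assoc, hb2,
      one_mul, inv_eq_of_mul_eq_one_left hb2]
  have hbζ : b ∉ ζ.range := by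
    intro h
    have := Subgroup.orderOf_dvd_natCard _ h
    rw [hb, ← Nat.card_congr (MonoidHom.ofInjective hζ).toEquiv,
      Nat.card_congr Multiplicative.toAdd, Nat.card_zmod] at this
    norm_num at this
  refine ⟨(MulEquiv.ofBijective (dihedralLift ζ b hb2 hinvert) ?_).symm⟩
  exact (Nat.bijective_iff_injective_and_card _).2
    ⟨dihedralLift_injective hb2 hinvert hζ hbζ, by rw [hG, DihedralGroup.nat_card]⟩

end DihedralGroup

section NecessaryConditions

theorem IsPDCIGroup.isPCIGroup (h : IsPDCIGroup m G) : IsPCIGroup m G :=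
  fun Γ hΓ => h Γ hΓ.1

theorem IsPCIGroup.lt_five_of_prime_dvd_card [Finite G] (h : IsPCIGroup m G) (hm : 4 ≤ m) {p : ℕ}
    (hp : p.Prime) (hpG : p ∣ Nat.card G) : p < 5 := by
  by_contra! hp5
  have := Fact.mk hp
  obtain ⟨g, hg⟩ := exists_prime_orderOf_dvd_card' p hpG
  exact not_isPCIGroup_of_odd_orderOf hm (hg ▸ hp5) (hg ▸ hp.odd_of_ne_two (by omega)) h

theorem IsPCIGroup.not_sq_dvd_card [Finite G] (h : IsPCIGroup m G) (hm : 4 ≤ m) {p : ℕ}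
    (hp : p.Prime) : ¬ p ^ 2 ∣ Nat.card G := by
  intro hpG
  have := Fact.mk hp
  obtain ⟨K, hK⟩ := Sylow.exists_subgroup_card_pow_prime p hpG
  by_cases hcyc : IsCyclic K
  · obtain ⟨g, hg⟩ := IsCyclic.exists_ofOrder_eq_natCard (α := K)
    rw [hK, ← Subgroup.orderOf_coe] at hg
    rcases hp.eq_two_or_odd' with rfl | hodd
    · exact not_isPCIGroup_of_orderOf_eq_four hm hg h
    · have hp3 : 3 ≤ p := by have := hp.two_le; have := hodd.ne_two_of_dvd_nat dvd_rfl; omega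
      exact not_isPCIGroup_of_odd_orderOf hm (by rw [hg]; nlinarith) (by rw [hg]; exact hodd.pow) h
  · exact not_isPCIGroup_of_not_isCyclic hm hp K hK hcyc h

theorem IsPCIGroup.card_dvd_six [Finite G] (h : IsPCIGroup m G) (hm : 4 ≤ m) :
    Nat.card G ∣ 6 := by
  have hsq : Squarefree (Nat.card G) := Nat.squarefree_iff_prime_squarefree.2 fun p hp =>
    pow_two p ▸ h.not_sq_dvd_card hm hp
  have hsubset : (Nat.card G).primeFactors ⊆ {2, 3} := by
    intro p hp
    obtain ⟨hp, hpG, -⟩ := Nat.mem_primeFactors.1 hp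
    have := h.lt_five_of_prime_dvd_card hm hp hpG
    interval_cases p <;> revert hp <;> decide
  rw [← Nat.prod_primeFactors_of_squarefree hsq]
  exact Finset.prod_dvd_prod_of_subset _ _ _ hsubset

theorem nonempty_mulEquiv_zmod_of_prime {p : ℕ} [Fact p.Prime] (hG : Nat.card G = p) :
    Nonempty (G ≃* Multiplicative (ZMod p)) :=
  ⟨mulEquivOfPrimeCardEq hG (by simp)⟩

theorem IsPCIGroup.nonempty_mulEquiv [Finite G] (h : IsPCIGroup m G) (hm : 4 ≤ m) :
    Nonempty (G ≃* Multiplicative (ZMod 1)) ∨ Nonempty (G ≃* Multiplicative (ZMod 2)) ∨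
      Nonempty (G ≃* Multiplicative (ZMod 3)) ∨ Nonempty (G ≃* DihedralGroup 3) := by
  have hcard : Nat.card G ∈ Nat.divisors 6 :=
    Nat.mem_divisors.2 ⟨h.card_dvd_six hm, by norm_num⟩
  have hcases : Nat.card G = 1 ∨ Nat.card G = 2 ∨ Nat.card G = 3 ∨ Nat.card G = 6 := by
    simpa [show Nat.divisors 6 = {1, 2, 3, 6} from rfl] using hcard
  refine hcases.imp (fun h1 => ?_) (Or.imp nonempty_mulEquiv_zmod_of_prime
    (Or.imp nonempty_mulEquiv_zmod_of_prime fun h6 => ?_))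
  · have := (Nat.card_eq_one_iff_unique.1 h1).1
    have := uniqueOfSubsingleton (1 : G)
    exact ⟨MulEquiv.ofUnique⟩
  · exact nonempty_mulEquiv_dihedralGroup_three h6
      fun g hg => not_isPCIGroup_of_orderOf_eq_six hm hg h

theorem exists_orderOf_eq_three (h : Nonempty (G ≃* Multiplicative (ZMod 3)) ∨
    Nonempty (G ≃* DihedralGroup 3)) : ∃ g : G, orderOf g = 3 := by
  rcases h with ⟨⟨e⟩⟩ | ⟨⟨e⟩⟩
  · refine ⟨e.symm (ofAdd 1), ?_⟩
    rw [MulEquiv.orderOf_eq, orderOf_ofAdd_eq_addOrderOf, ZMod.addOrderOf_one]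
  · exact ⟨e.symm (.r 1), by rw [MulEquiv.orderOf_eq, DihedralGroup.orderOf_r_one]⟩

end NecessaryConditions

/-! ### Automorphisms fixing the blocks -/

section BlockAut

open scoped Pointwise

variable {ι X : Type*} {Γ : Digraph (ι × X)}

/-- The automorphisms of `Γ` that map every fibre `{i} × X` of the vertex set to itself. -/
def blockAut (Γ : Digraph (ι × X)) : Subgroup (Equiv.Perm (ι × X)) where
  carrier := {a | (∀ u v, Γ.Adj (a u) (a v) ↔ Γ.Adj u v) ∧ ∀ v, (a v).1 = v.1}
  one_mem' := ⟨fun _ _ => Iff.rfl, fun _ => rfl⟩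
  mul_mem' := by
    rintro a b ⟨ha, ha'⟩ ⟨hb, hb'⟩
    exact ⟨fun u v => (ha _ _).trans (hb u v), fun v => (ha' _).trans (hb' v)⟩
  inv_mem' := by
    rintro a ⟨ha, ha'⟩
    exact ⟨fun u v => by rw [← ha]; simp, fun v => by rw [← ha']; simp⟩

theorem mem_iff_of_sameCycle {V : Type*} {r : Equiv.Perm V} {s : Set V}
    (hs : ∀ v, r v ∈ s ↔ v ∈ s) {u v : V} (h : r.SameCycle u v) : u ∈ s ↔ v ∈ s := by
  obtain ⟨k, rfl⟩ := h
  have hr : r ∈ MulAction.stabilizer (Equiv.Perm V) s := MulAction.mem_stabilizer_set.2 hs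
  exact (MulAction.mem_stabilizer_set.1 (zpow_mem hr k) u).symm

theorem fst_eq_of_sameCycle {r : Equiv.Perm (ι × X)} (hr : ∀ v, (r v).1 = v.1) {u v : ι × X}
    (h : r.SameCycle u v) : u.1 = v.1 := by
  have := mem_iff_of_sameCycle (s := {w | u.1 = w.1}) (fun w => by simp [hr]) h
  simpa using this

theorem exists_restrict_mem_blockAut (hΓ : IsGraph Γ) {r f : Equiv.Perm (ι × X)}
    (hr : r ∈ blockAut Γ) {s : Set (ι × X)} (hs : ∀ v, r v ∈ s ↔ v ∈ s)
    (hf : ∀ v, r.SameCycle v (f v))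
    (hfadj : ∀ u ∈ s, ∀ v ∈ s, Γ.Adj (f u) (f v) ↔ Γ.Adj u v)
    (hadj : ∀ u ∈ s, ∀ v ∉ s, Γ.Adj u (r v) ↔ Γ.Adj u v) :
    ∃ F ∈ blockAut Γ, (∀ v ∈ s, F v = f v) ∧ ∀ v ∉ s, F v = v := by
  classical
  have hfs (v) : f v ∈ s ↔ v ∈ s := (mem_iff_of_sameCycle hs (hf v)).symm
  have adj_comm (u v) : Γ.Adj u v ↔ Γ.Adj v u := ⟨hΓ u v, hΓ v u⟩
  let F : Equiv.Perm (ι × X) := Equiv.Perm.ofSubtype (f.subtypePerm hfs)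
  have apply_mem (v) (hv : v ∈ s) : F v = f v := Equiv.Perm.ofSubtype_apply_of_mem _ hv
  have apply_notMem (v) (hv : v ∉ s) : F v = v := Equiv.Perm.ofSubtype_apply_of_not_mem _ hv
  have adj_apply_left (u) (hu : u ∈ s) (v) (hv : v ∉ s) : Γ.Adj (f u) v ↔ Γ.Adj u v := by
    have hinv (w) : (r w ∈ s ∧ Γ.Adj (r w) v) ↔ (w ∈ s ∧ Γ.Adj w v) := by
      rw [hs, and_congr_right_iff]
      exact fun hw => by rw [← hadj _ ((hs w).2 hw) v hv, hr.1]
    have := mem_iff_of_sameCycle (s := {w | w ∈ s ∧ Γ.Adj w v}) hinv (hf u)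
    simpa [hfs, hu] using this.symm
  refine ⟨F, ⟨fun u v => ?_, fun v => ?_⟩, apply_mem, apply_notMem⟩
  · by_cases hu : u ∈ s <;> by_cases hv : v ∈ s
    · rw [apply_mem u hu, apply_mem v hv, hfadj u hu v hv]
    · rw [apply_mem u hu, apply_notMem v hv, adj_apply_left u hu v hv]
    · rw [apply_notMem u hu, apply_mem v hv, adj_comm, adj_apply_left v hv u hu, adj_comm]
    · rw [apply_notMem u hu, apply_notMem v hv]
  · by_cases hv : v ∈ s
    · rw [apply_mem v hv, fst_eq_of_sameCycle hr.2 (hf v)]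
    · rw [apply_notMem v hv]

end BlockAut

section ConjRightMul

variable {σ : Equiv.Perm (Fin m × G)} {x : G}

theorem rightMul_mem_blockAut (S : Fin m → Fin m → Set G) (g : G) :
    rightMul m g ∈ blockAut (cay S) :=
  ⟨cay_adj_rightMul S g, fun _ => rfl⟩

/-- The conjugate of the right multiplication `R(x)` by `σ`. If `σ` is an isomorphism from `Γ` to
an `m`-PCayley digraph, then this is an automorphism of `Γ`. -/
def conjRightMul (σ : Equiv.Perm (Fin m × G)) (x : G) : Equiv.Perm (Fin m × G) :=
  σ⁻¹ * rightMul m x * σ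

theorem apply_conjRightMul (σ : Equiv.Perm (Fin m × G)) (x : G) (v : Fin m × G) :
    σ (conjRightMul σ x v) = rightMul m x (σ v) := by
  simp [conjRightMul]

theorem conjRightMul_mul (σ : Equiv.Perm (Fin m × G)) (x y : G) :
    conjRightMul σ (x * y) = conjRightMul σ y * conjRightMul σ x := by
  simp only [conjRightMul, rightMul_mul]
  group

theorem conjRightMul_one (σ : Equiv.Perm (Fin m × G)) : conjRightMul σ 1 = 1 := by
  rw [conjRightMul, rightMul_one, mul_one, inv_mul_cancel]

theorem conjRightMul_inv (σ : Equiv.Perm (Fin m × G)) (x : G) :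
    conjRightMul σ x⁻¹ = (conjRightMul σ x)⁻¹ := by
  rw [eq_inv_iff_mul_eq_one, ← conjRightMul_mul, mul_inv_cancel, conjRightMul_one]

theorem conjRightMul_pow_eq_one {k : ℕ} (hx : x ^ k = 1) (σ : Equiv.Perm (Fin m × G)) :
    conjRightMul σ x ^ k = 1 := by
  have := conj_pow (a := σ⁻¹) (b := rightMul m x) (i := k)
  rw [inv_inv] at this
  rw [conjRightMul, this, ← rightMul_pow, hx, rightMul_one, mul_one, inv_mul_cancel]

theorem conjRightMul_mul_left (σ a : Equiv.Perm (Fin m × G)) (x : G) :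
    conjRightMul (σ * a) x = a⁻¹ * conjRightMul σ x * a := by
  simp only [conjRightMul]
  group

theorem conjRightMul_mem_blockAut_mul {Γ : Digraph (Fin m × G)} {a : Equiv.Perm (Fin m × G)}
    (hσ : conjRightMul σ x ∈ blockAut Γ) (ha : a ∈ blockAut Γ) :
    conjRightMul (σ * a) x ∈ blockAut Γ := by
  rw [conjRightMul_mul_left]
  exact mul_mem (mul_mem (inv_mem ha) hσ) ha

theorem rightMul_apply_ne (hx : x ≠ 1) (v : Fin m × G) : rightMul m x v ≠ v :=
  fun h => hx (by simpa using congrArg Prod.snd h)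

theorem conjRightMul_apply_ne (hx : x ≠ 1) (v : Fin m × G) : conjRightMul σ x v ≠ v :=
  fun h => rightMul_apply_ne hx (σ v) (by rw [← apply_conjRightMul, h])

/-- A form of Babai's criterion for the CI-property. -/
theorem isPCI_of_forall_exists_mul_mem_normalizer {Γ : Digraph (Fin m × G)}
    (h : ∀ σ : Equiv.Perm (Fin m × G), (∀ x, conjRightMul σ x ∈ blockAut Γ) →
      ∃ a ∈ blockAut Γ,
        σ * a ∈ Subgroup.normalizer (rightMulGroup m G : Set (Equiv.Perm (Fin m × G)))) :
    IsPCI Γ := by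
  rintro Δ ⟨T, -, rfl⟩ ⟨σ, hσ, hblock⟩
  have conj_mem (x : G) : conjRightMul σ x ∈ blockAut Γ := by
    refine ⟨fun u v => ?_, fun v => ?_⟩
    · rw [hσ, hσ u v, apply_conjRightMul, apply_conjRightMul, cay_adj_rightMul]
    · rw [← fst_apply_eq_iff_of_image_block hblock, apply_conjRightMul, rightMul_apply]
  obtain ⟨a, ha, hn⟩ := h σ conj_mem
  refine ⟨σ * a, hn, image_eq_of_adj_iff fun u v => ?_⟩
  rw [← ha.1, hσ]
  rfl

end ConjRightMul

/-! ### Permutations that agree up to inversion -/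

section EqUpToInv

variable {V : Type*} {r h : Equiv.Perm V}

/-- `r` is a product of disjoint `3`-cycles without fixed points, and `h` arises from `r` by
inverting some of these cycles. -/
structure EqUpToInv (r h : Equiv.Perm V) : Prop where
  pow_three : r ^ 3 = 1
  apply_ne : ∀ v, r v ≠ v
  apply_eq_or : ∀ v, h v = r v ∨ h v = r⁻¹ v

/-- The points that lie on those cycles of `r` that are not inverted in `h`. -/
def agreeSet (r h : Equiv.Perm V) : Set V := {v | h v = r v}

namespace EqUpToInv

variable (he : EqUpToInv r h)

include he

theorem apply_apply (v : V) : r (r v) = r⁻¹ v := by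
  rw [Equiv.Perm.eq_inv_iff_eq]
  simpa [pow_succ] using congrArg (fun f : Equiv.Perm V => f v) he.pow_three

theorem inv_apply_ne_apply (v : V) : r⁻¹ v ≠ r v := by
  rw [← he.apply_apply]
  exact he.apply_ne _

theorem inv_left : EqUpToInv r⁻¹ h where
  pow_three := by rw [inv_pow, he.pow_three, inv_one]
  apply_ne v := fun hv => he.apply_ne v (Equiv.Perm.inv_eq_iff_eq.1 hv).symm
  apply_eq_or v := by simpa [or_comm] using he.apply_eq_or v

theorem apply_eq_inv_of_notMem {v : V} (hv : v ∉ agreeSet r h) : h v = r⁻¹ v :=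
  (he.apply_eq_or v).resolve_left hv

theorem agreeSet_inv_left : agreeSet r⁻¹ h = (agreeSet r h)ᶜ := by
  ext v
  refine ⟨fun hv hv' => he.inv_apply_ne_apply v ?_, he.apply_eq_inv_of_notMem⟩
  rw [← show h v = r v from hv', ← show h v = r⁻¹ v from hv]

theorem apply_mem_agreeSet {v : V} (hv : v ∈ agreeSet r h) : r v ∈ agreeSet r h := by
  by_contra hrv
  have h_apply : h v = r v := hv
  have h_apply_apply : h (r v) = v := by simpa using he.apply_eq_inv_of_notMem hrv
  rcases he.apply_eq_or (r⁻¹ v) with h_inv | h_inv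
  · exact he.inv_apply_ne_apply v (h.injective (by rw [h_inv, h_apply_apply]; simp))
  · refine he.inv_left.apply_ne v (h.injective ?_)
    rw [h_inv, he.inv_left.apply_apply, inv_inv, h_apply]

theorem apply_mem_agreeSet_iff (v : V) : r v ∈ agreeSet r h ↔ v ∈ agreeSet r h := by
  refine ⟨fun hv => ?_, he.apply_mem_agreeSet⟩
  have := he.apply_mem_agreeSet (he.apply_mem_agreeSet hv)
  simpa [he.apply_apply] using this

theorem sameCycle_iff {v w : V} : h.SameCycle v w ↔ r.SameCycle v w := by
  constructor
  · intro hvw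
    refine (mem_iff_of_sameCycle (s := {w | r.SameCycle v w}) (fun x => ?_) hvw).1 (.refl r v)
    rcases he.apply_eq_or x with hx | hx <;> simp [hx]
  · intro hvw
    refine (mem_iff_of_sameCycle (s := {w | h.SameCycle v w}) (fun x => ?_) hvw).1 (.refl h v)
    by_cases hx : x ∈ agreeSet r h
    · simp [← show h x = r x from hx]
    · have h_apply : h (r x) = x := by
        simpa using he.apply_eq_inv_of_notMem (mt (he.apply_mem_agreeSet_iff x).1 hx)
      change h.SameCycle v (r x) ↔ h.SameCycle v x
      rw [← Equiv.Perm.sameCycle_apply_right, h_apply]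

end EqUpToInv

variable {ι X : Type*} {Γ : Digraph (ι × X)} {r h : Equiv.Perm (ι × X)}

theorem EqUpToInv.adj_apply_iff_of_mem_of_notMem (he : EqUpToInv r h) (hr : r ∈ blockAut Γ)
    (hh : h ∈ blockAut Γ) {u v : ι × X} (hu : u ∈ agreeSet r h) (hv : v ∉ agreeSet r h) :
    Γ.Adj u (r v) ↔ Γ.Adj u v := by
  rw [← hh.1 u v, show h u = r u from hu, he.apply_eq_inv_of_notMem hv, ← he.apply_apply, hr.1]

theorem EqUpToInv.adj_apply_iff (he : EqUpToInv r h) (hr : r ∈ blockAut Γ)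
    (hh : h ∈ blockAut Γ) {u v : ι × X} (huv : ¬ (u ∈ agreeSet r h ↔ v ∈ agreeSet r h)) :
    Γ.Adj u (r v) ↔ Γ.Adj u v := by
  by_cases hu : u ∈ agreeSet r h
  · exact he.adj_apply_iff_of_mem_of_notMem hr hh hu fun hv => huv (iff_of_true hu hv)
  · have hv : r v ∈ agreeSet r h := by
      rw [he.apply_mem_agreeSet_iff]
      by_contra hv
      exact huv (iff_of_false hu hv)
    have := he.inv_left.adj_apply_iff_of_mem_of_notMem (u := u) (v := r v) (inv_mem hr) hh
      (by rwa [he.agreeSet_inv_left]) (by rwa [he.agreeSet_inv_left, Set.notMem_compl_iff])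
    simpa using this.symm

end EqUpToInv

section Sylow

variable {p : ℕ} [Fact p.Prime]

theorem isPGroup_zpowers_of_pow_eq_one {A : Type*} [Group A] {a : A} (ha : a ^ p = 1) :
    IsPGroup p (Subgroup.zpowers a) := by
  obtain ⟨k, -, hk⟩ := (Nat.dvd_prime_pow Fact.out).1
    (show orderOf a ∣ p ^ 1 by simpa using orderOf_dvd_of_pow_eq_one ha)
  exact IsPGroup.of_card (n := k) (by rw [Nat.card_zpowers, hk])

theorem exists_sylow_mem_and_conj_mem {A : Type*} [Group A] [Finite A] {r h : A}
    (hr : r ^ p = 1) (hh : h ^ p = 1) : ∃ (P : Sylow p A) (a : A), r ∈ P ∧ a⁻¹ * h * a ∈ P := by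
  obtain ⟨P, hP⟩ := (isPGroup_zpowers_of_pow_eq_one hr).exists_le_sylow
  obtain ⟨Q, hQ⟩ := (isPGroup_zpowers_of_pow_eq_one hh).exists_le_sylow
  obtain ⟨k, rfl⟩ := MulAction.exists_smul_eq A Q P
  exact ⟨_, k⁻¹, hP (Subgroup.mem_zpowers r), h, hQ (Subgroup.mem_zpowers h), by simp⟩

theorem sameCycle_apply_of_isPGroup {V : Type*} [Finite V] {P : Subgroup (Equiv.Perm V)}
    (hP : IsPGroup p P) {r c : Equiv.Perm V} (hr : r ∈ P) (hc : c ∈ P) {v : V} (hv : r v ≠ v)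
    (horbit : (MulAction.orbit P v).ncard < p ^ 2) : r.SameCycle v (c v) := by
  have hle : Subgroup.zpowers r ≤ P := Subgroup.zpowers_le.2 hr
  have horbit_subset : MulAction.orbit (Subgroup.zpowers r) v ⊆ MulAction.orbit P v := by
    rintro _ ⟨⟨x, hx⟩, rfl⟩
    exact ⟨⟨x, hle hx⟩, rfl⟩
  obtain ⟨n, hn⟩ := hP.card_orbit v
  obtain ⟨k, hk⟩ := (hP.to_le hle).card_orbit v
  have one_lt : 1 < p := (Fact.out : p.Prime).one_lt
  have hk0 : k ≠ 0 := by
    rintro rfl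
    obtain ⟨w, hw⟩ := Set.ncard_eq_one.1 hk
    have hrv : r v ∈ MulAction.orbit (Subgroup.zpowers r) v :=
      ⟨⟨r, Subgroup.mem_zpowers r⟩, rfl⟩
    have hvv := MulAction.mem_orbit_self (M := Subgroup.zpowers r) v
    rw [hw] at hrv hvv
    exact hv (hrv.trans hvv.symm)
  have hn2 : n < 2 := (Nat.pow_lt_pow_iff_right one_lt).1 (hn ▸ horbit)
  have horbit_eq := Set.eq_of_subset_of_ncard_le horbit_subset
    (by
      change Nat.card _ ≤ Nat.card _
      rw [hn, hk]
      exact Nat.pow_le_pow_right one_lt.le (by omega))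
  have hcv : c v ∈ MulAction.orbit P v := ⟨⟨c, hc⟩, rfl⟩
  rw [← horbit_eq] at hcv
  obtain ⟨⟨_, j, rfl⟩, hj⟩ := hcv
  exact ⟨j, hj⟩

variable {ι X : Type*} [Finite X] {Γ : Digraph (ι × X)} {r h : Equiv.Perm (ι × X)}

theorem ncard_orbit_le_of_le_blockAut {P : Subgroup (Equiv.Perm (ι × X))} (hP : P ≤ blockAut Γ)
    (v : ι × X) : (MulAction.orbit P v).ncard ≤ Nat.card X := by
  have hsubset : MulAction.orbit P v ⊆ Set.range (Prod.mk v.1) := by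
    rintro _ ⟨⟨x, hx⟩, rfl⟩
    exact ⟨(x v).2, Prod.ext ((hP hx).2 v).symm rfl⟩
  calc (MulAction.orbit P v).ncard ≤ (Set.range (Prod.mk v.1)).ncard := Set.ncard_le_ncard hsubset
    _ = Nat.card X := by
      rw [← Set.image_univ, Set.ncard_image_of_injective _ (Prod.mk_right_injective _),
        Set.ncard_univ]

variable [Finite ι]

theorem exists_conj_sameCycle_of_card_lt (hX : Nat.card X < p ^ 2) (hr : r ∈ blockAut Γ)
    (hh : h ∈ blockAut Γ) (hrp : r ^ p = 1) (hhp : h ^ p = 1) (hne : ∀ v, r v ≠ v) :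
    ∃ a ∈ blockAut Γ, ∀ v, r.SameCycle v ((a⁻¹ * h * a) v) := by
  obtain ⟨P, a, hrP, haP⟩ := exists_sylow_mem_and_conj_mem (p := p) (r := (⟨r, hr⟩ : blockAut Γ))
    (h := ⟨h, hh⟩) (Subtype.ext hrp) (Subtype.ext hhp)
  refine ⟨a, a.2, fun v => ?_⟩
  exact sameCycle_apply_of_isPGroup (P.isPGroup'.map (blockAut Γ).subtype) ⟨_, hrP, rfl⟩
    ⟨_, haP, rfl⟩ (hne v)
    ((ncard_orbit_le_of_le_blockAut (Subgroup.map_subtype_le _) v).trans_lt hX)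

theorem eqUpToInv_of_sameCycle {V : Type*} {r h : Equiv.Perm V} (hr : r ^ 3 = 1)
    (hrne : ∀ v, r v ≠ v) (hhne : ∀ v, h v ≠ v) (hrh : ∀ v, r.SameCycle v (h v)) :
    EqUpToInv r h := by
  refine ⟨hr, hrne, fun v => ?_⟩
  obtain ⟨k, hk⟩ := hrh v
  rcases eq_or_eq_or_eq_inv_of_mem_zpowers hr (zpow_mem (Subgroup.mem_zpowers r) k) with
    h1 | hr | hrinv
  · exact absurd hk.symm (by simpa [h1] using hhne v)
  · exact .inl (by rw [← hk, hr])
  · exact .inr (by rw [← hk, hrinv])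

theorem exists_conj_eqUpToInv (hX : Nat.card X < 9) (hr : r ∈ blockAut Γ) (hh : h ∈ blockAut Γ)
    (hr3 : r ^ 3 = 1) (hh3 : h ^ 3 = 1) (hrne : ∀ v, r v ≠ v) (hhne : ∀ v, h v ≠ v) :
    ∃ a ∈ blockAut Γ, EqUpToInv r (a⁻¹ * h * a) := by
  obtain ⟨a, ha, hsame⟩ := exists_conj_sameCycle_of_card_lt (p := 3) hX hr hh hr3 hh3 hrne
  exact ⟨a, ha, eqUpToInv_of_sameCycle hr3 hrne
    (fun v hv => hhne (a v) (Equiv.Perm.inv_eq_iff_eq.1 hv)) hsame⟩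

end Sylow

/-! ### Flips -/

section Flips

variable {ρ : G} {f : Equiv.Perm G}

/-- `f` maps every left coset of `⟨ρ⟩` to itself and inverts the right multiplication by `ρ`. -/
structure IsFlip (ρ : G) (f : Equiv.Perm G) : Prop where
  apply_mul : ∀ x, f (x * ρ) = f x * ρ⁻¹
  inv_mul_apply_mem : ∀ x, x⁻¹ * f x ∈ Subgroup.zpowers ρ

theorem IsFlip.inv (hf : IsFlip ρ f) : IsFlip ρ⁻¹ f where
  apply_mul x := by
    have := hf.apply_mul (x * ρ⁻¹)
    rw [inv_mul_cancel_right, eq_mul_inv_iff_mul_eq] at this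
    rw [← this, inv_inv]
  inv_mul_apply_mem x := by
    rw [Subgroup.zpowers_inv]
    exact hf.inv_mul_apply_mem x

theorem IsFlip.symm_mulEquiv {H : Type*} [Group H] (e : G ≃* H) {ρ : H} {f : Equiv.Perm H}
    (hf : IsFlip ρ f) : IsFlip (e.symm ρ) ((e.toEquiv.trans f).trans e.symm.toEquiv) where
  apply_mul x := by simp [hf.apply_mul]
  inv_mul_apply_mem x := by
    obtain ⟨k, hk⟩ := hf.inv_mul_apply_mem (e x)
    exact ⟨k, e.injective (by simpa using hk)⟩

/-- For every `A ⊆ G`, the bipartite graph on two copies of `G` with the arcs `(x, a * x)`,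
`a ∈ A`, has an automorphism that acts on both copies as a flip. -/
def HasFlips (ρ : G) : Prop :=
  ∀ A : Set G, ∃ f f' : Equiv.Perm G, IsFlip ρ f ∧ IsFlip ρ f' ∧
    ∀ x y, y * x⁻¹ ∈ A ↔ f' y * (f x)⁻¹ ∈ A

theorem HasFlips.inv (hρ : HasFlips ρ) : HasFlips ρ⁻¹ := fun A =>
  have ⟨f, f', hf, hf', hff'⟩ := hρ A
  ⟨f, f', hf.inv, hf'.inv, hff'⟩

theorem HasFlips.symm_mulEquiv {H : Type*} [Group H] (e : G ≃* H) {ρ : H} (hρ : HasFlips ρ) :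
    HasFlips (e.symm ρ) := by
  intro A
  obtain ⟨f, f', hf, hf', hff'⟩ := hρ (e.symm ⁻¹' A)
  refine ⟨_, _, hf.symm_mulEquiv e, hf'.symm_mulEquiv e, fun x y => ?_⟩
  simpa using hff' (e x) (e y)

theorem HasFlips.exists_isFlip_family (hρ : HasFlips ρ) {S : Fin m → Fin m → Set G}
    (hS : ∀ i, S i i = ∅) (hΓ : IsGraph (cay S)) {B : Finset (Fin m)} (hB : B.card ≤ 2) :
    ∃ φ : Fin m → Equiv.Perm G, (∀ i, IsFlip ρ (φ i)) ∧
      ∀ i ∈ B, ∀ j ∈ B, ∀ x y, y * x⁻¹ ∈ S i j ↔ φ j y * (φ i x)⁻¹ ∈ S i j := by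
  rcases hB.lt_or_eq with hB | hB
  · obtain ⟨f, -, hf, -⟩ := hρ ∅
    refine ⟨fun _ => f, fun _ => hf, fun i hi j hj x y => ?_⟩
    obtain rfl := Finset.card_le_one.1 (Nat.lt_succ_iff.1 hB) i hi j hj
    simp [hS]
  · obtain ⟨a, b, hab, rfl⟩ := Finset.card_eq_two.1 hB
    obtain ⟨f, f', hf, hf', hff'⟩ := hρ (S a b)
    have mem_swap (s) : s ∈ S b a ↔ s⁻¹ ∈ S a b := by
      have : (cay S).Adj (b, 1) (a, s) ↔ (cay S).Adj (a, s) (b, 1) := ⟨hΓ _ _, hΓ _ _⟩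
      simpa [cay_adj_iff] using this
    refine ⟨fun i => if i = a then f else f', fun i => ?_, fun i hi j hj x y => ?_⟩
    · dsimp only
      split_ifs <;> assumption
    · rw [Finset.mem_insert, Finset.mem_singleton] at hi hj
      rcases hi with rfl | rfl <;> rcases hj with rfl | rfl
      · simp [hS]
      · simpa [hab.symm] using hff' x y
      · simpa [hab.symm, mem_swap] using hff' y x
      · simp [hS]

theorem sameCycle_rightMul_iff {v w : Fin m × G} :
    (rightMul m ρ).SameCycle v w ↔ v.1 = w.1 ∧ v.2⁻¹ * w.2 ∈ Subgroup.zpowers ρ := by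
  have zpow_apply (k : ℤ) : (rightMul m ρ ^ k) v = (v.1, v.2 * ρ ^ k) := by
    cases k <;> simp [← rightMul_pow, ← rightMul_inv]
  constructor
  · rintro ⟨k, rfl⟩
    simp [zpow_apply]
  · rintro ⟨hfst, k, hk⟩
    refine ⟨k, ?_⟩
    rw [zpow_apply]
    exact Prod.ext hfst (eq_inv_mul_iff_mul_eq.1 hk)

variable {S : Fin m → Fin m → Set G} {h : Equiv.Perm (Fin m × G)}

theorem EqUpToInv.exists_conj_eq_inv (he : EqUpToInv (rightMul m ρ) h) (hρ : HasFlips ρ)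
    (hS : ∀ i, S i i = ∅) (hΓ : IsGraph (cay S)) (hh : h ∈ blockAut (cay S))
    {B : Finset (Fin m)} (hB : B.card ≤ 2) (hagree : ∀ v, v ∈ agreeSet (rightMul m ρ) h ↔ v.1 ∈ B) :
    ∃ a ∈ blockAut (cay S), a⁻¹ * h * a = (rightMul m ρ)⁻¹ := by
  have hr := rightMul_mem_blockAut S ρ
  obtain ⟨φ, hφ, hφS⟩ := hρ.exists_isFlip_family hS hΓ hB
  obtain ⟨F, hF, apply_mem, apply_notMem⟩ := exists_restrict_mem_blockAut hΓ hr
    (f := Equiv.prodCongrRight φ) (s := agreeSet (rightMul m ρ) h) he.apply_mem_agreeSet_iff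
    (fun v => sameCycle_rightMul_iff.2 ⟨rfl, (hφ v.1).inv_mul_apply_mem v.2⟩)
    (fun u hu v hv => by
      rw [cay_adj_iff, cay_adj_iff]
      exact (hφS _ ((hagree u).1 hu) _ ((hagree v).1 hv) _ _).symm)
    (fun u hu v hv => he.adj_apply_iff_of_mem_of_notMem hr hh hu hv)
  refine ⟨F, hF, ?_⟩
  rw [mul_assoc, inv_mul_eq_iff_eq_mul]
  ext1 v
  change h (F v) = F ((rightMul m ρ)⁻¹ v)
  by_cases hv : v ∈ agreeSet (rightMul m ρ) h
  · have hFv : F v ∈ agreeSet (rightMul m ρ) h := by rwa [hagree, hF.2, ← hagree]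
    have hrv : (rightMul m ρ)⁻¹ v ∈ agreeSet (rightMul m ρ) h := by
      rwa [hagree, (inv_mem hr).2, ← hagree]
    rw [show h (F v) = _ from hFv, apply_mem v hv, apply_mem _ hrv, ← rightMul_inv]
    exact Prod.ext rfl (by simpa using ((hφ v.1).inv.apply_mul v.2).symm)
  · have hrv : (rightMul m ρ)⁻¹ v ∉ agreeSet (rightMul m ρ) h := by
      rwa [hagree, (inv_mem hr).2, ← hagree]
    rw [apply_notMem v hv, apply_notMem _ hrv, he.apply_eq_inv_of_notMem hv]

theorem EqUpToInv.exists_conj_eq_or_eq_inv (he : EqUpToInv (rightMul m ρ) h) (hm : m ≤ 5)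
    (hρ : HasFlips ρ) (hS : ∀ i, S i i = ∅) (hΓ : IsGraph (cay S)) (hh : h ∈ blockAut (cay S))
    (hconst : ∀ u v : Fin m × G, u.1 = v.1 → u ∈ agreeSet (rightMul m ρ) h →
      v ∈ agreeSet (rightMul m ρ) h) :
    ∃ a ∈ blockAut (cay S), a⁻¹ * h * a = rightMul m ρ ∨ a⁻¹ * h * a = (rightMul m ρ)⁻¹ := by
  classical
  let B : Finset (Fin m) := {i | (i, 1) ∈ agreeSet (rightMul m ρ) h}
  have mem_iff (v) : v ∈ agreeSet (rightMul m ρ) h ↔ v.1 ∈ B := by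
    rw [Finset.mem_filter_univ]
    exact ⟨hconst v (v.1, 1) rfl, hconst (v.1, 1) v rfl⟩
  have hcard : B.card ≤ 2 ∨ Bᶜ.card ≤ 2 := by
    have := Finset.card_add_card_compl B
    rw [Fintype.card_fin] at this
    omega
  rcases hcard with hB | hB
  · obtain ⟨a, ha, hah⟩ := he.exists_conj_eq_inv hρ hS hΓ hh hB mem_iff
    exact ⟨a, ha, .inr hah⟩
  · have heinv := he.inv_left
    rw [← rightMul_inv] at heinv
    obtain ⟨a, ha, hah⟩ := heinv.exists_conj_eq_inv hρ.inv hS hΓ hh hB fun v => by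
      rw [rightMul_inv, he.agreeSet_inv_left, Set.mem_compl_iff, mem_iff, Finset.mem_compl]
    rw [rightMul_inv, inv_inv] at hah
    exact ⟨a, ha, .inl hah⟩

end Flips

theorem exists_forall_mem_iff_sub_mem (A : Set (ZMod 3)) : ∃ c, ∀ k, k ∈ A ↔ c - k ∈ A := by
  have forall_of_three (c : ZMod 3) (h0 : 0 ∈ A ↔ c - 0 ∈ A) (h1 : 1 ∈ A ↔ c - 1 ∈ A)
      (h2 : 2 ∈ A ↔ c - 2 ∈ A) (k) : k ∈ A ↔ c - k ∈ A := by
    fin_cases k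
    exacts [h0, h1, h2]
  have pigeonhole : (0 ∈ A ↔ 1 ∈ A) ∨ (0 ∈ A ↔ 2 ∈ A) ∨ (1 ∈ A ↔ 2 ∈ A) := by tauto
  rcases pigeonhole with h | h | h
  · exact ⟨1, forall_of_three 1 h h.symm .rfl⟩
  · exact ⟨2, forall_of_three 2 h .rfl h.symm⟩
  · exact ⟨0, forall_of_three 0 .rfl h h.symm⟩

theorem hasFlips_zmod_three : HasFlips (ofAdd (1 : ZMod 3)) := by
  intro A
  obtain ⟨c, hc⟩ := exists_forall_mem_iff_sub_mem (ofAdd ⁻¹' A)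
  refine ⟨.inv _, (Equiv.inv _).trans (.mulLeft (ofAdd c)), ⟨fun x => ?_, fun x => ?_⟩,
    ⟨fun x => ?_, fun x => ?_⟩, fun x y => ?_⟩
  · simp [mul_comm]
  · simp [zpowers_ofAdd_one]
  · simpa [mul_assoc] using mul_comm _ _
  · simp [zpowers_ofAdd_one]
  · have := hc (y * x⁻¹).toAdd
    simpa [sub_eq_add_neg, mul_assoc, mul_comm x] using this

section Dihedral

open DihedralGroup

theorem r_mem_zpowers_r_one {n : ℕ} (i : ZMod n) : r i ∈ Subgroup.zpowers (r 1 : DihedralGroup n) :=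
  ⟨i.cast, by simp⟩

theorem sr_notMem_zpowers_r_one {n : ℕ} (i : ZMod n) :
    sr i ∉ Subgroup.zpowers (r 1 : DihedralGroup n) := by
  rintro ⟨k, hk⟩
  simp at hk

/-- The involution `x ↦ sr a * x * sr 0` of the dihedral group. -/
def dihedralFlip {n : ℕ} (a : ZMod n) : Equiv.Perm (DihedralGroup n) :=
  (Equiv.mulLeft (sr a)).trans (Equiv.mulRight (sr 0))

theorem dihedralFlip_apply {n : ℕ} (a : ZMod n) (x : DihedralGroup n) :
    dihedralFlip a x = sr a * x * sr 0 := rfl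

theorem isFlip_dihedralFlip {n : ℕ} (a : ZMod n) : IsFlip (r 1) (dihedralFlip a) where
  apply_mul x := by
    have : r 1 * sr 0 = sr 0 * (r (1 : ZMod n))⁻¹ := by simp
    rw [dihedralFlip_apply, dihedralFlip_apply, mul_assoc _ (sr 0), ← this]
    simp only [mul_assoc]
  inv_mul_apply_mem x := by
    rw [dihedralFlip_apply]
    rcases x with i | i
    · simpa using r_mem_zpowers_r_one _
    · simpa using r_mem_zpowers_r_one _

theorem hasFlips_dihedralGroup_three : HasFlips (r 1 : DihedralGroup 3) := by
  intro A
  obtain ⟨c, hc⟩ := exists_forall_mem_iff_sub_mem {k | r k ∈ A}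
  obtain ⟨d, hd⟩ := exists_forall_mem_iff_sub_mem {k | sr k ∈ A}
  -- In `ZMod 3` the pair `(p, q) = (c - d, -(c + d))` solves `q - p = c` and `q + p = d`, so that
  -- `sr p * r k * sr q = r (c - k)` and `sr p * sr k * sr q = sr (d - k)`.
  refine ⟨dihedralFlip (-(c + d)), dihedralFlip (c - d), isFlip_dihedralFlip _,
    isFlip_dihedralFlip _, fun x y => ?_⟩
  have hxy : dihedralFlip (c - d) y * (dihedralFlip (-(c + d)) x)⁻¹ =
      sr (c - d) * (y * x⁻¹) * sr (-(c + d)) := by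
    rw [dihedralFlip_apply, dihedralFlip_apply, mul_inv_rev, mul_inv_rev, inv_sr, inv_sr,
      mul_assoc _ (sr 0), ← mul_assoc (sr 0) (sr 0), sr_mul_self, one_mul]
    simp only [mul_assoc]
  have three_eq_zero : (3 : ZMod 3) = 0 := rfl
  rw [hxy]
  rcases y * x⁻¹ with k | k
  · have : -(c + d) - (c - d + k) = c - k := by linear_combination -c * three_eq_zero
    rw [sr_mul_r, sr_mul_sr, this]
    exact hc k
  · have : -(c + d) - (k - (c - d)) = d - k := by linear_combination -d * three_eq_zero
    rw [sr_mul_sr, r_mul_sr, this]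
    exact hd k

end Dihedral

/-! ### The groups `Z_3` and `D_6` are `m`PCI for `m ≤ 5` -/

section Union

variable {ι X : Type*} {Γ : Digraph (ι × X)} {r h t u : Equiv.Perm (ι × X)}

theorem apply_apply_apply_of_semiconjBy_inv {V : Type*} {t r : Equiv.Perm V}
    (htr : SemiconjBy t r r⁻¹) (v : V) : r (t (r v)) = t v :=
  Equiv.Perm.eq_inv_iff_eq.1 (DFunLike.congr_fun htr.eq v)

theorem EqUpToInv.apply_apply_mem_agreeSet_iff {V : Type*} {r h t : Equiv.Perm V}
    (he : EqUpToInv r h) (htr : SemiconjBy t r r⁻¹) (v : V) :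
    t (r v) ∈ agreeSet r h ↔ t v ∈ agreeSet r h := by
  rw [← he.apply_mem_agreeSet_iff (t (r v)), apply_apply_apply_of_semiconjBy_inv htr]

theorem EqUpToInv.adj_apply_iff_of_semiconjBy (he : EqUpToInv r h) (hr : r ∈ blockAut Γ)
    (hh : h ∈ blockAut Γ) (ht : t ∈ blockAut Γ) (htr : SemiconjBy t r r⁻¹) {v w : ι × X}
    (hvw : ¬ (t v ∈ agreeSet r h ↔ t w ∈ agreeSet r h)) : Γ.Adj v (r w) ↔ Γ.Adj v w := by
  have hvw' : ¬ (t v ∈ agreeSet r h ↔ t (r w) ∈ agreeSet r h) := by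
    rwa [he.apply_apply_mem_agreeSet_iff htr]
  rw [← ht.1, ← he.adj_apply_iff hr hh hvw', apply_apply_apply_of_semiconjBy_inv htr, ht.1]

theorem EqUpToInv.exists_conj_mem_agreeSet_iff (he : EqUpToInv r h) (hΓ : IsGraph Γ)
    (hr : r ∈ blockAut Γ) (hh : h ∈ blockAut Γ) (ht : t ∈ blockAut Γ) (hu : u ∈ blockAut Γ)
    (htr : SemiconjBy t r r⁻¹) (huh : SemiconjBy u h h⁻¹)
    (hut : ∀ v, r.SameCycle v ((u * t) v)) :
    ∃ a ∈ blockAut Γ, EqUpToInv r (a⁻¹ * h * a) ∧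
      ∀ v, v ∈ agreeSet r (a⁻¹ * h * a) ↔ v ∈ agreeSet r h ∨ t v ∈ agreeSet r h := by
  let s : Set (ι × X) := {v | v ∉ agreeSet r h ∧ t v ∈ agreeSet r h}
  have hs (v) : r v ∈ s ↔ v ∈ s := by
    change r v ∉ _ ∧ t (r v) ∈ _ ↔ v ∉ _ ∧ t v ∈ _
    rw [he.apply_mem_agreeSet_iff, he.apply_apply_mem_agreeSet_iff htr]
  obtain ⟨F, hF, apply_mem, apply_notMem⟩ := exists_restrict_mem_blockAut hΓ hr hs hut
    (fun v _ w _ => (mul_mem hu ht).1 v w) (fun v hv w hw => by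
      by_cases hwh : w ∈ agreeSet r h
      · exact he.adj_apply_iff hr hh fun hvw => hv.1 (hvw.2 hwh)
      · exact he.adj_apply_iff_of_semiconjBy hr hh ht htr fun hvw => hw ⟨hwh, hvw.1 hv.2⟩)
  have conj_apply_mem (v) (hv : v ∈ s) : (F⁻¹ * h * F) v = r v := by
    have h_apply : h (t (r v)) = t v := by
      rw [show h (t (r v)) = r (t (r v)) from (he.apply_apply_mem_agreeSet_iff htr v).2 hv.2,
        apply_apply_apply_of_semiconjBy_inv htr]
    change F⁻¹ (h (F v)) = r v
    rw [Equiv.Perm.inv_eq_iff_eq, apply_mem v hv, apply_mem _ ((hs v).2 hv)]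
    change h (u (t v)) = u (t (r v))
    rw [← h_apply, apply_apply_apply_of_semiconjBy_inv huh]
  have conj_apply_notMem (v) (hv : v ∉ s) : (F⁻¹ * h * F) v = h v := by
    have hhv : h v ∉ s := by
      rcases he.apply_eq_or v with hvr | hvr <;> rw [hvr]
      · rwa [hs]
      · rwa [← hs, ← Equiv.Perm.mul_apply, mul_inv_cancel, Equiv.Perm.one_apply]
    change F⁻¹ (h (F v)) = h v
    rw [apply_notMem v hv, Equiv.Perm.inv_eq_iff_eq, apply_notMem _ hhv]
  refine ⟨F, hF, ⟨he.pow_three, he.apply_ne, fun v => ?_⟩, fun v => ?_⟩ <;> by_cases hv : v ∈ s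
  · exact .inl (conj_apply_mem v hv)
  · rw [conj_apply_notMem v hv]
    exact he.apply_eq_or v
  · exact iff_of_true (conj_apply_mem v hv) (.inr hv.2)
  · change (F⁻¹ * h * F) v = r v ↔ _
    rw [conj_apply_notMem v hv]
    exact ⟨.inl, fun hor => hor.elim id fun htv => by_contra fun hv' => hv ⟨hv', htv⟩⟩

end Union

theorem pow_eq_one_of_sameCycle {V : Type*} {r c : Equiv.Perm V} {n : ℕ} (hcr : Commute c r)
    (hr : r ^ n = 1) (hc : ∀ v, r.SameCycle v (c v)) : c ^ n = 1 := by
  ext1 v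
  obtain ⟨k, hk⟩ := hc v
  have hfix : Function.IsFixedPt (((r ^ k)⁻¹ * c : Equiv.Perm V)) v :=
    Equiv.Perm.inv_eq_iff_eq.2 hk.symm
  have hpow : ((r ^ k)⁻¹ * c) ^ n = c ^ n := by
    rw [(hcr.zpow_right k).inv_right.symm.mul_pow, inv_pow, ← zpow_natCast, zpow_comm, zpow_natCast,
      hr, one_zpow, inv_one, one_mul]
  rw [← hpow]
  exact hfix.perm_pow n

theorem inv_mul_mul_eq_of_pow_three {A : Type*} [Group A] {t u : A} (ht : t * t = 1)
    (hu : u * u = 1) (hut : (u * t) ^ 3 = 1) : (t * u)⁻¹ * u * (t * u) = t := by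
  rw [mul_inv_rev, inv_eq_of_mul_eq_one_left ht, inv_eq_of_mul_eq_one_left hu]
  rw [pow_three] at hut
  calc u * t * u * (t * u) = u * t * (u * t * (u * t)) * t⁻¹ := by group
    _ = t := by rw [hut, one_mul, inv_eq_of_mul_eq_one_left ht]

section Normalize

variable {S : Fin m → Fin m → Set G} {σ : Equiv.Perm (Fin m × G)} {ρ τ : G}

theorem exists_eqUpToInv_conjRightMul [Finite G] (hG : Nat.card G < 9) (hρ : orderOf ρ = 3)
    (hσ : conjRightMul σ ρ ∈ blockAut (cay S)) :
    ∃ a ∈ blockAut (cay S), EqUpToInv (rightMul m ρ) (conjRightMul (σ * a) ρ) := by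
  have hρ3 : ρ ^ 3 = 1 := by rw [← hρ, pow_orderOf_eq_one]
  have hρ1 : ρ ≠ 1 := by
    rintro rfl
    simp at hρ
  simp only [conjRightMul_mul_left]
  exact exists_conj_eqUpToInv hG (rightMul_mem_blockAut S ρ) hσ
    (by rw [← rightMul_pow, hρ3, rightMul_one]) (conjRightMul_pow_eq_one hρ3 σ)
    (rightMul_apply_ne hρ1) (conjRightMul_apply_ne hρ1)

theorem exists_conjRightMul_eq_or_eq_inv (hm : m ≤ 5) (hρ : HasFlips ρ) (hS : ∀ i, S i i = ∅)
    (hΓ : IsGraph (cay S)) (hσ : conjRightMul σ ρ ∈ blockAut (cay S))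
    (he : EqUpToInv (rightMul m ρ) (conjRightMul σ ρ))
    (hconst : ∀ u v : Fin m × G, u.1 = v.1 → u ∈ agreeSet (rightMul m ρ) (conjRightMul σ ρ) →
      v ∈ agreeSet (rightMul m ρ) (conjRightMul σ ρ)) :
    ∃ a ∈ blockAut (cay S), conjRightMul (σ * a) ρ = rightMul m ρ ∨
      conjRightMul (σ * a) ρ = (rightMul m ρ)⁻¹ := by
  simp only [conjRightMul_mul_left]
  exact he.exists_conj_eq_or_eq_inv hm hρ hS hΓ hσ hconst

theorem mem_rightMulGroup_of_eq_or_eq_inv {h : Equiv.Perm (Fin m × G)}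
    (hh : h = rightMul m ρ ∨ h = (rightMul m ρ)⁻¹) : h ∈ rightMulGroup m G := by
  rcases hh with rfl | rfl
  · exact ⟨ρ, rfl⟩
  · exact inv_mem ⟨ρ, rfl⟩

theorem isPCIGroup_of_zpowers_eq_top (hm : m ≤ 5) (hρ : orderOf ρ = 3)
    (htop : Subgroup.zpowers ρ = ⊤) (hflips : HasFlips ρ) : IsPCIGroup m G := by
  have hcard : Nat.card G = 3 := by rw [← hρ, orderOf_eq_card_of_zpowers_eq_top htop]
  have : Finite G := Nat.finite_of_card_ne_zero (by omega)
  rintro _ ⟨⟨S, hS, rfl⟩, hΓ⟩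
  refine isPCI_of_forall_exists_mul_mem_normalizer fun σ hσ => ?_
  obtain ⟨a, ha, he⟩ := exists_eqUpToInv_conjRightMul (by omega) hρ (hσ ρ)
  obtain ⟨b, hb, heq⟩ := exists_conjRightMul_eq_or_eq_inv hm hflips hS hΓ
    (conjRightMul_mem_blockAut_mul (hσ ρ) ha) he fun v w hvw =>
      (mem_iff_of_sameCycle he.apply_mem_agreeSet_iff
        (sameCycle_rightMul_iff.2 ⟨hvw, by simp [htop]⟩)).1
  refine ⟨a * b, mul_mem ha hb, mem_normalizer_of_closure_eq_top (s := {ρ}) ?_ ?_⟩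
  · rwa [← Subgroup.zpowers_eq_closure]
  · rintro _ rfl
    rw [← mul_assoc]
    exact mem_rightMulGroup_of_eq_or_eq_inv heq

theorem rightMul_semiconjBy (hτρ : SemiconjBy τ ρ ρ⁻¹) :
    SemiconjBy (rightMul m τ) (rightMul m ρ) (rightMul m ρ)⁻¹ := by
  have : SemiconjBy (rightMul m τ) (rightMul m ρ)⁻¹ (rightMul m ρ) := by
    rw [SemiconjBy, ← rightMul_inv, ← rightMul_mul, ← rightMul_mul, hτρ.eq]
  simpa using this.inv_right

theorem conjRightMul_semiconjBy (hτρ : SemiconjBy τ ρ ρ⁻¹) (σ : Equiv.Perm (Fin m × G)) :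
    SemiconjBy (conjRightMul σ τ) (conjRightMul σ ρ) (conjRightMul σ ρ)⁻¹ := by
  have : SemiconjBy (conjRightMul σ τ) (conjRightMul σ ρ)⁻¹ (conjRightMul σ ρ) := by
    rw [SemiconjBy, ← conjRightMul_inv, ← conjRightMul_mul, ← conjRightMul_mul, hτρ.eq]
  simpa using this.inv_right

theorem sameCycle_rightMul_of_not_sameCycle (hindex : (Subgroup.zpowers ρ).index = 2)
    {u v w : Fin m × G} (huv : u.1 = v.1) (hvw : v.1 = w.1)
    (huv' : ¬ (rightMul m ρ).SameCycle u v) (hvw' : ¬ (rightMul m ρ).SameCycle v w) :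
    (rightMul m ρ).SameCycle u w := by
  rw [sameCycle_rightMul_iff, not_and] at huv' hvw'
  refine sameCycle_rightMul_iff.2 ⟨huv.trans hvw, ?_⟩
  have : u.2⁻¹ * w.2 = u.2⁻¹ * v.2 * (v.2⁻¹ * w.2) := by group
  rw [this, Subgroup.mul_mem_iff_of_index_two hindex]
  exact iff_of_false (huv' huv) (hvw' hvw)

theorem not_sameCycle_rightMul_apply (hτ : τ ∉ Subgroup.zpowers ρ) (v : Fin m × G) :
    ¬ (rightMul m ρ).SameCycle v (rightMul m τ v) := by
  simpa [sameCycle_rightMul_iff] using hτ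

theorem closure_pair_eq_top_of_index_two (hindex : (Subgroup.zpowers ρ).index = 2)
    (hτ : τ ∉ Subgroup.zpowers ρ) : Subgroup.closure {ρ, τ} = ⊤ := by
  have hτmem : τ ∈ Subgroup.closure {ρ, τ} := Subgroup.subset_closure (by simp)
  have hle : Subgroup.zpowers ρ ≤ Subgroup.closure {ρ, τ} :=
    Subgroup.zpowers_le.2 (Subgroup.subset_closure (by simp))
  refine (Subgroup.eq_top_iff' _).2 fun x => ?_
  by_cases hx : x ∈ Subgroup.zpowers ρ
  · exact hle hx
  · have : x * τ ∈ Subgroup.zpowers ρ :=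
      (Subgroup.mul_mem_iff_of_index_two hindex).2 (iff_of_false hx hτ)
    exact (Subgroup.mul_mem_cancel_right _ hτmem).1 (hle this)

theorem EqUpToInv.sameCycle_conjRightMul_rightMul_apply
    (he : EqUpToInv (rightMul m ρ) (conjRightMul σ ρ))
    (hindex : (Subgroup.zpowers ρ).index = 2) (hτ : τ ∉ Subgroup.zpowers ρ)
    (hσ : ∀ v, (conjRightMul σ τ v).1 = v.1) (v : Fin m × G) :
    (rightMul m ρ).SameCycle v ((conjRightMul σ τ * rightMul m τ) v) := by
  refine sameCycle_rightMul_of_not_sameCycle (v := rightMul m τ v) hindex rfl (hσ _).symm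
    (not_sameCycle_rightMul_apply hτ v) fun hcycle => ?_
  have : (σ⁻¹ * rightMul m ρ * σ⁻¹⁻¹).SameCycle (rightMul m τ v)
      (conjRightMul σ τ (rightMul m τ v)) := by
    rw [inv_inv]
    exact he.sameCycle_iff.2 hcycle
  rw [Equiv.Perm.sameCycle_conj, inv_inv, apply_conjRightMul] at this
  exact not_sameCycle_rightMul_apply hτ _ this

theorem EqUpToInv.exists_conjRightMul_agreeSet_const
    (he : EqUpToInv (rightMul m ρ) (conjRightMul σ ρ))
    (hindex : (Subgroup.zpowers ρ).index = 2) (hτ : τ ∉ Subgroup.zpowers ρ) (hττ : τ * τ = 1)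
    (hτρ : SemiconjBy τ ρ ρ⁻¹) (hΓ : IsGraph (cay S))
    (hσ : ∀ x, conjRightMul σ x ∈ blockAut (cay S)) :
    ∃ a ∈ blockAut (cay S), EqUpToInv (rightMul m ρ) (conjRightMul (σ * a) ρ) ∧
      ∀ u v : Fin m × G, u.1 = v.1 → u ∈ agreeSet (rightMul m ρ) (conjRightMul (σ * a) ρ) →
        v ∈ agreeSet (rightMul m ρ) (conjRightMul (σ * a) ρ) := by
  obtain ⟨a, ha, hea, hagree⟩ := he.exists_conj_mem_agreeSet_iff hΓ (rightMul_mem_blockAut S ρ)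
    (hσ ρ) (rightMul_mem_blockAut S τ) (hσ τ) (rightMul_semiconjBy hτρ)
    (conjRightMul_semiconjBy hτρ σ)
    (he.sameCycle_conjRightMul_rightMul_apply hindex hτ (hσ τ).2)
  rw [← conjRightMul_mul_left] at hea hagree
  refine ⟨a, ha, hea, fun u v huv hu => ?_⟩
  have mem_iff {v w} := mem_iff_of_sameCycle (u := v) (v := w) hea.apply_mem_agreeSet_iff
  have htt (w : Fin m × G) : rightMul m τ (rightMul m τ w) = w := by
    simp [mul_assoc, hττ]
  by_cases hcycle : (rightMul m ρ).SameCycle u v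
  · exact (mem_iff hcycle).1 hu
  · have hcycle' : (rightMul m ρ).SameCycle (rightMul m τ u) v :=
      sameCycle_rightMul_of_not_sameCycle (v := u) hindex rfl huv
        (fun h => not_sameCycle_rightMul_apply hτ u h.symm) hcycle
    rwa [← mem_iff hcycle', hagree, htt, or_comm, ← hagree]

theorem EqUpToInv.exists_mul_mem_normalizer [Finite G]
    (he : EqUpToInv (rightMul m ρ) (conjRightMul σ ρ))
    (hindex : (Subgroup.zpowers ρ).index = 2) (hτ : τ ∉ Subgroup.zpowers ρ) (hττ : τ * τ = 1)
    (hτρ : SemiconjBy τ ρ ρ⁻¹) (hσ : ∀ x, conjRightMul σ x ∈ blockAut (cay S))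
    (heq : conjRightMul σ ρ = rightMul m ρ ∨ conjRightMul σ ρ = (rightMul m ρ)⁻¹) :
    ∃ a ∈ blockAut (cay S),
      σ * a ∈ Subgroup.normalizer (rightMulGroup m G : Set (Equiv.Perm (Fin m × G))) := by
  set r := rightMul m ρ
  set t := rightMul m τ
  set u := conjRightMul σ τ
  have htt : t * t = 1 := by rw [← rightMul_mul, hττ, rightMul_one]
  have huu : u * u = 1 := by rw [← conjRightMul_mul, hττ, conjRightMul_one]
  have htr : SemiconjBy t r r⁻¹ := rightMul_semiconjBy hτρ
  have hur : SemiconjBy u r⁻¹ r := by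
    have huh := conjRightMul_semiconjBy hτρ σ
    rcases heq with heq | heq <;> rw [heq] at huh
    · simpa using huh.inv_right
    · simpa using huh
  have hutr : Commute (u * t) r := hur.mul_left htr
  have hut : (u * t) ^ 3 = 1 := pow_eq_one_of_sameCycle hutr he.pow_three
    (he.sameCycle_conjRightMul_rightMul_apply hindex hτ (hσ τ).2)
  refine ⟨t * u, mul_mem (rightMul_mem_blockAut S τ) (hσ τ),
    mem_normalizer_of_closure_eq_top (closure_pair_eq_top_of_index_two hindex hτ) ?_⟩
  change ∀ x ∈ _, conjRightMul (σ * (t * u)) x ∈ _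
  simp only [conjRightMul_mul_left]
  rintro x (hx | hx) <;> rw [hx]
  · have : Commute (t * u)⁻¹ (conjRightMul σ ρ) := by
      rw [mul_inv_rev, inv_eq_of_mul_eq_one_left htt, inv_eq_of_mul_eq_one_left huu]
      rcases heq with heq | heq <;> rw [heq]
      exacts [hutr, hutr.inv_right]
    rw [this.eq, inv_mul_cancel_right]
    exact mem_rightMulGroup_of_eq_or_eq_inv heq
  · exact ⟨τ, (inv_mul_mul_eq_of_pow_three htt huu hut).symm⟩

theorem isPCIGroup_of_index_zpowers_eq_two (hm : m ≤ 5) (hρ : orderOf ρ = 3)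
    (hindex : (Subgroup.zpowers ρ).index = 2) (hτ : τ ∉ Subgroup.zpowers ρ) (hττ : τ * τ = 1)
    (hτρ : SemiconjBy τ ρ ρ⁻¹) (hflips : HasFlips ρ) : IsPCIGroup m G := by
  have hcard : Nat.card G = 6 := by
    rw [← (Subgroup.zpowers ρ).card_mul_index, hindex, Nat.card_zpowers, hρ]
  have : Finite G := Nat.finite_of_card_ne_zero (by omega)
  rintro _ ⟨⟨S, hS, rfl⟩, hΓ⟩
  refine isPCI_of_forall_exists_mul_mem_normalizer fun σ hσ => ?_
  obtain ⟨a, ha, he⟩ := exists_eqUpToInv_conjRightMul (by omega) hρ (hσ ρ)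
  have hσa x := conjRightMul_mem_blockAut_mul (hσ x) ha
  obtain ⟨b, hb, heb, hconst⟩ := he.exists_conjRightMul_agreeSet_const hindex hτ hττ hτρ hΓ hσa
  have hσb x := conjRightMul_mem_blockAut_mul (hσa x) hb
  obtain ⟨c, hc, heq⟩ := exists_conjRightMul_eq_or_eq_inv hm hflips hS hΓ (hσb ρ) heb hconst
  have hec : EqUpToInv (rightMul m ρ) (conjRightMul (σ * a * b * c) ρ) :=
    ⟨he.pow_three, he.apply_ne, fun v => heq.imp (DFunLike.congr_fun · v) (DFunLike.congr_fun · v)⟩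
  obtain ⟨d, hd, hn⟩ := hec.exists_mul_mem_normalizer hindex hτ hττ hτρ
    (fun x => conjRightMul_mem_blockAut_mul (hσb x) hc) heq
  exact ⟨a * b * c * d, mul_mem (mul_mem (mul_mem ha hb) hc) hd, by simpa only [mul_assoc] using hn⟩

end Normalize

theorem isPCIGroup_of_mulEquiv_zmod_three (hm : m ≤ 5) (e : G ≃* Multiplicative (ZMod 3)) :
    IsPCIGroup m G := by
  refine isPCIGroup_of_zpowers_eq_top hm (ρ := e.symm (ofAdd 1)) ?_ ?_
    (hasFlips_zmod_three.symm_mulEquiv e)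
  · rw [MulEquiv.orderOf_eq, orderOf_ofAdd_eq_addOrderOf, ZMod.addOrderOf_one]
  · rw [← MulEquiv.coe_toMonoidHom, ← MonoidHom.map_zpowers, zpowers_ofAdd_one]
    exact Subgroup.map_top_of_surjective _ e.symm.surjective

open DihedralGroup in
theorem isPCIGroup_of_mulEquiv_dihedralGroup_three (hm : m ≤ 5) (e : G ≃* DihedralGroup 3) :
    IsPCIGroup m G := by
  have hρ : orderOf (e.symm (r 1)) = 3 := by rw [MulEquiv.orderOf_eq, orderOf_r_one]
  refine isPCIGroup_of_index_zpowers_eq_two hm (τ := e.symm (sr 0)) hρ ?_ ?_ ?_ ?_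
    (hasFlips_dihedralGroup_three.symm_mulEquiv e)
  · have := (Subgroup.zpowers (e.symm (r 1))).card_mul_index
    rw [Nat.card_zpowers, hρ, Nat.card_congr e.toEquiv, DihedralGroup.nat_card] at this
    omega
  · rintro ⟨k, hk⟩
    exact sr_notMem_zpowers_r_one 0 ⟨k, e.symm.injective ((map_zpow e.symm _ k).trans hk)⟩
  · rw [← map_mul, sr_mul_self, map_one]
  · rw [← map_inv]
    exact (show SemiconjBy (sr 0) (r 1) (r 1)⁻¹ by simp [SemiconjBy]).map e.symm

/-! ### Groups of order at most two -/

theorem eq_of_ne_of_ne_of_card_le_two {α : Type*} [Finite α] (hα : Nat.card α ≤ 2) {a b c : α}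
    (hb : b ≠ a) (hc : c ≠ a) : b = c := by
  by_contra hbc
  have hncard : ({a, b, c} : Set α).ncard = 3 :=
    Set.ncard_eq_three.2 ⟨a, b, c, hb.symm, hc.symm, hbc, rfl⟩
  have := Set.ncard_le_card ({a, b, c} : Set α)
  omega

theorem conjRightMul_eq_rightMul_of_card_le_two [Finite G] (hG : Nat.card G ≤ 2)
    {σ : Equiv.Perm (Fin m × G)} {x : G} (hσ : ∀ v, (conjRightMul σ x v).1 = v.1) :
    conjRightMul σ x = rightMul m x := by
  obtain rfl | hx := eq_or_ne x 1
  · rw [conjRightMul_one, rightMul_one]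
  ext1 v
  refine Prod.ext (hσ v) (eq_of_ne_of_ne_of_card_le_two hG (a := v.2) ?_ ?_)
  · exact fun h => conjRightMul_apply_ne hx v (Prod.ext (hσ v) h)
  · exact fun h => rightMul_apply_ne hx v (Prod.ext rfl h)

theorem isPDCIGroup_of_card_le_two [Finite G] (hG : Nat.card G ≤ 2) : IsPDCIGroup m G := by
  rintro _ ⟨S, -, rfl⟩
  refine isPCI_of_forall_exists_mul_mem_normalizer fun σ hσ => ⟨1, one_mem _, ?_⟩
  rw [mul_one]
  exact mem_normalizer_of_closure_eq_top Subgroup.closure_univ fun x _ =>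
    ⟨x, (conjRightMul_eq_rightMul_of_card_le_two hG (hσ x).2).symm⟩

theorem isPDCIGroup_of_mulEquiv_zmod_one (e : G ≃* Multiplicative (ZMod 1)) :
    IsPDCIGroup m G :=
  have := Finite.of_equiv _ e.symm.toEquiv
  isPDCIGroup_of_card_le_two (by rw [Nat.card_congr e.toEquiv]; simp)

theorem isPDCIGroup_of_mulEquiv_zmod_two (e : G ≃* Multiplicative (ZMod 2)) :
    IsPDCIGroup m G :=
  have := Finite.of_equiv _ e.symm.toEquiv
  isPDCIGroup_of_card_le_two (by rw [Nat.card_congr e.toEquiv]; simp)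

end MCayley

theorem mainTheorem1 (m : ℕ) (hm : 4 ≤ m) (G : Type*) [Group G] [Finite G] :
    (MCayley.IsPCIGroup m G ↔
      Nonempty (G ≃* Multiplicative (ZMod 1)) ∨ Nonempty (G ≃* Multiplicative (ZMod 2)) ∨
        ((Nonempty (G ≃* Multiplicative (ZMod 3)) ∨ Nonempty (G ≃* DihedralGroup 3)) ∧
          (m = 4 ∨ m = 5))) ∧
    (MCayley.IsPDCIGroup m G ↔
      Nonempty (G ≃* Multiplicative (ZMod 1)) ∨ Nonempty (G ≃* Multiplicative (ZMod 2))) := by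
  refine ⟨⟨fun h => ?_, ?_⟩, fun h => ?_, ?_⟩
  · rcases h.nonempty_mulEquiv hm with h1 | h2 | h3
    · exact Or.inl h1
    · exact Or.inr (Or.inl h2)
    · refine Or.inr (Or.inr ⟨h3, ?_⟩)
      obtain ⟨g, hg⟩ := MCayley.exists_orderOf_eq_three h3
      by_contra hm'
      exact MCayley.not_isPCIGroup_of_orderOf_eq_three (by omega) hg h
  · rintro (⟨⟨e⟩⟩ | ⟨⟨e⟩⟩ | ⟨⟨⟨e⟩⟩ | ⟨⟨e⟩⟩, hm'⟩)
    · exact (MCayley.isPDCIGroup_of_mulEquiv_zmod_one e).isPCIGroup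
    · exact (MCayley.isPDCIGroup_of_mulEquiv_zmod_two e).isPCIGroup
    · exact MCayley.isPCIGroup_of_mulEquiv_zmod_three (by omega) e
    · exact MCayley.isPCIGroup_of_mulEquiv_dihedralGroup_three (by omega) e
  · rcases h.isPCIGroup.nonempty_mulEquiv hm with h1 | h2 | h3
    · exact Or.inl h1
    · exact Or.inr h2
    · obtain ⟨g, hg⟩ := MCayley.exists_orderOf_eq_three h3
      exact absurd h (MCayley.not_isPDCIGroup_of_orderOf_eq_three hm hg)
  · rintro (⟨⟨e⟩⟩ | ⟨⟨e⟩⟩)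
    · exact MCayley.isPDCIGroup_of_mulEquiv_zmod_one e
    · exact MCayley.isPDCIGroup_of_mulEquiv_zmod_two e
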